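/- Let $\overline\rho>0$ and consider $\rho_t+f(\rho)_x=(D(\rho)\rho_x)_x+g(\rho)$, where $f,D\in C^1[0,\overline\rho]$, $f(0)=0$, $g\in C[0,\overline\rho]$; put $h=f'$ and write $\dot D$ for the derivative of $D$ (one-sided at the end points of $[0,\overline\rho]$). \emph{Definitions.} Let $I\subseteq\mathbb R$ be an open interval and $c\in\mathbb R$. A continuous function $\varphi:I\to[0,\overline\rho]$, differentiable a.e., with $D(\varphi)\varphi'\in L^1_{\rm loc}(I)$, is the profile of a \emph{traveling wave} $\rho(x,t)=\varphi(x-ct)$ with speed $c$ on $I$ if $$\int_I\big\{\big(D(\varphi)\varphi'-f(\varphi)+c\varphi\big)\psi'-g(\varphi)\psi\big\}\,d\xi=0\qquad\text{for all }\psi\in C_0^\infty(I);$$ here $D(\varphi)\varphi'$ is understood to be also the distributional derivative of $\int_0^{\varphi}D(s)\,ds$. It is \emph{classical} in an open set $U\subseteq I$ if $\varphi$ is differentiable in $U$, $D(\varphi)\varphi'$ is locally absolutely continuous in $U$ and $(D(\varphi)\varphi')'+(c-h(\varphi))\varphi'+g(\varphi)=0$ a.e. in $U$; it is \emph{classical}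 if this holds for $U=I$. It is \emph{sharp at $\ell$} if $g(\ell)=0$ and there is $\xi_0\in I$ with $\varphi(\xi_0)=\ell$ such that $\varphi$ is classical in $I\setminus\{\xi_0\}$ and not differentiable at $\xi_0$; it is \emph{sharp} if it is sharp at some $\ell$. It is \emph{strict} if $I\ne\mathbb R$ and $\varphi$ is not the restriction to $I$ of a traveling-wave profile with speed $c$ on $\mathbb R$. It is a \emph{semi-wavefront from $\ell$}, where $\ell\in[0,\overline\rho]$ and $g(\ell)=0$, if $I=(-\infty,\varpi)$ with $\varpi\in\mathbb R$, $\varphi$ is (weakly) monotone and not constant, and $\varphi(\xi)\to\ell$ as $\xi\to-\infty$. \emph{Theorem.} Assume $D>0$ on $(0,\overline\rho)$, $g<0$ on $(0,\overline\rho]$ and $g(0)=0$. Then for every $c\in\mathbb R$ there is a semi-wavefront $\varphi:(-\infty,\varpi)\to[0,\overline\rho]$ from $0$ with speed $c$ which is classical or sharp, is strict, and is unique up to shifts in the class of classical or sharp solutions: every classical or sharp semi-wavefront from $0$ with speed $c$, defined on $(-\infty,\varpi')$ say, has the form $\xi\mapsto\varphi(\xi+\tau)$ on $(-\infty,\varpi')$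 for some $\tau\in\mathbb R$ with $\varpi'+\tau\le\varpi$. Moreover: \begin{itemize} \item if $D(0)>0$, then $\varphi$ is classical; \item if $D(0)=0$ and $c<h(0)$, then $\varphi$ is sharp (at $0$); \item if $D(0)=0$ and $c>h(0)$, then $\varphi$ is classical; \item if $D(0)=0$, $c=h(0)$ and $\dot D(0)>0$, then $\varphi$ is classical. \end{itemize} If $D(0)=0$, $c=h(0)$ and $\dot D(0)=0$, then $\varphi$ can be of either type: for every $\overline\rho>0$ and $c\in\mathbb R$ there are $f,D,g$ satisfying all the assumptions, with $D(0)=\dot D(0)=0$ and $h(0)=c$, for which there is a classical semi-wavefront from $0$ with speed $c$, and there are such $f,D,g$ for which there is a semi-wavefront from $0$ with speed $c$ that is sharp at $0$. -/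

import Mathlib

open MeasureTheory Filter Topology Set
open scoped ContDiff

namespace SemiWave

/-- Regularity of the flux `f`, the diffusivity `D` and the source term `g` on `[0, r]`. Only the
values of these functions on `[0, r]` matter. -/
structure IsData (r : ℝ) (f D g : ℝ → ℝ) : Prop where
  f_contDiffOn : ContDiffOn ℝ 1 f (Icc 0 r)
  f_zero : f 0 = 0
  D_contDiffOn : ContDiffOn ℝ 1 D (Icc 0 r)
  g_continuousOn : ContinuousOn g (Icc 0 r)

/-- The diffusivity is positive in the open interval `(0, r)`. -/
def DHat (r : ℝ) (D : ℝ → ℝ) : Prop := ∀ s ∈ Ioo 0 r, 0 < D s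

/-- The source term is negative in `(0, r]` and vanishes at `0`. -/
def GHat (r : ℝ) (g : ℝ → ℝ) : Prop := (∀ s ∈ Ioc 0 r, g s < 0) ∧ g 0 = 0

/-- The derivative on `[0, r]`, one-sided at the end points. -/
noncomputable def dot (r : ℝ) (F : ℝ → ℝ) (s : ℝ) : ℝ := derivWithin F (Icc 0 r) s

/-- The function `D(φ) φ'`. -/
noncomputable def diffFlux (D φ : ℝ → ℝ) (ξ : ℝ) : ℝ := D (φ ξ) * deriv φ ξ

/-- `φ` is the profile, on the open interval `I`, of a traveling-wave solution
`ρ(x,t) = φ (x - c t)` of `ρ_t + f(ρ)_x = (D(ρ) ρ_x)_x + g(ρ)` with values in `[0, r]`. -/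
structure IsTravelingWave (r : ℝ) (f D g : ℝ → ℝ) (c : ℝ) (I : Set ℝ) (φ : ℝ → ℝ) : Prop where
  isOpen : IsOpen I
  ordConnected : I.OrdConnected
  mapsTo : MapsTo φ I (Icc 0 r)
  continuousOn : ContinuousOn φ I
  ae_differentiableAt : ∀ᵐ ξ ∂(volume.restrict I), DifferentiableAt ℝ φ ξ
  locallyIntegrableOn : LocallyIntegrableOn (diffFlux D φ) I volume
  /-- The function `D(φ) φ'` is the distributional derivative of `P(φ)`, where `P` is the primitive
  of `D`: the continuous function `φ` has no singular (Cantor) part that the pointwise derivative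
  would not see. -/
  weakDeriv : ∀ ψ : ℝ → ℝ, ContDiff ℝ ∞ ψ → HasCompactSupport ψ → tsupport ψ ⊆ I →
    ∫ ξ in I, (∫ s in (0 : ℝ)..(φ ξ), D s) * deriv ψ ξ = - ∫ ξ in I, diffFlux D φ ξ * ψ ξ
  weakEquation : ∀ ψ : ℝ → ℝ, ContDiff ℝ ∞ ψ → HasCompactSupport ψ → tsupport ψ ⊆ I →
    ∫ ξ in I, ((diffFlux D φ ξ - f (φ ξ) + c * φ ξ) * deriv ψ ξ - g (φ ξ) * ψ ξ) = 0

/-- `φ` is a classical solution of `(D(φ) φ')' + (c - h(φ)) φ' + g(φ) = 0`, `h = f'`, in the open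
set `U`: it is differentiable in `U`, the function `D(φ) φ'` is (locally) absolutely continuous,
and the equation holds almost everywhere. -/
structure IsClassicalOn (r : ℝ) (f D g : ℝ → ℝ) (c : ℝ) (U : Set ℝ) (φ : ℝ → ℝ) : Prop where
  differentiableAt : ∀ ξ ∈ U, DifferentiableAt ℝ φ ξ
  absolutelyContinuous : ∀ a b : ℝ, a ≤ b → Icc a b ⊆ U →
    AbsolutelyContinuousOnInterval (diffFlux D φ) a b
  equation : ∀ᵐ ξ ∂(volume.restrict U),
    deriv (diffFlux D φ) ξ + (c - dot r f (φ ξ)) * deriv φ ξ + g (φ ξ) = 0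

/-- `φ` is sharp at `l` in the open interval `I`. -/
def IsSharpAt (r : ℝ) (f D g : ℝ → ℝ) (c : ℝ) (I : Set ℝ) (φ : ℝ → ℝ) (l : ℝ) : Prop :=
  g l = 0 ∧ ∃ ξ₀ ∈ I, φ ξ₀ = l ∧ IsClassicalOn r f D g c (I \ {ξ₀}) φ ∧ ¬ DifferentiableAt ℝ φ ξ₀

/-- `φ` is classical or sharp (at some value) in `I`. -/
def IsClassicalOrSharp (r : ℝ) (f D g : ℝ → ℝ) (c : ℝ) (I : Set ℝ) (φ : ℝ → ℝ) : Prop :=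
  IsClassicalOn r f D g c I φ ∨ ∃ l, IsSharpAt r f D g c I φ l

/-- The profile `φ` on `I ≠ ℝ` does not extend to the profile of a traveling wave on `ℝ`. -/
def IsStrict (r : ℝ) (f D g : ℝ → ℝ) (c : ℝ) (I : Set ℝ) (φ : ℝ → ℝ) : Prop :=
  I ≠ univ ∧ ¬ ∃ Φ : ℝ → ℝ, IsTravelingWave r f D g c univ Φ ∧ EqOn Φ φ I

/-- `φ` is the profile, on `(-∞, b)`, of a semi-wavefront solution from `l`. -/
structure IsSemiWavefrontFrom (r : ℝ) (f D g : ℝ → ℝ) (c l b : ℝ) (φ : ℝ → ℝ) : Prop where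
  isTravelingWave : IsTravelingWave r f D g c (Iio b) φ
  mem_Icc : l ∈ Icc 0 r
  g_eq_zero : g l = 0
  monotonic : MonotoneOn φ (Iio b) ∨ AntitoneOn φ (Iio b)
  nonconstant : ¬ ∃ k, ∀ ξ ∈ Iio b, φ ξ = k
  tendsto : Tendsto φ atBot (𝓝 l)

end SemiWave

/-!
Let `P` be the primitive of `D`. Along an increasing wave that starts from `0`, the flux
`D(φ) φ' = P(φ)'` is a function `z` of the value `s` of the wave, which solves the singular problem
`z' = h - c - D g / z`, `z(0) = 0`. This problem has a positive solution, a monotone limit of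
solutions that start from the value `ε > 0`. Conversely `φ` is recovered from `z` by inverting the
travel time, a primitive of `D / z`; near `r` the travel time is finite because `z` is bounded and
`g < 0`.

* Uniqueness: the flux `w` of any wave satisfies `((w - z(θ))²)' ≤ 0`, again because `g ≤ 0`, and
  both `w` and `z(θ)` become arbitrarily small to the left. Hence `w = z(θ)`, and two waves differ
  by a shift.
* Type: `φ' = z(φ) / D(φ)`, so that regularity where `φ` reaches zero is a matter of the limit of
  `z / D` at `0`. It is found by comparing `z` with multiples of `D`.
* Strictness: an extension beyond the end point `b` would have the maximal value `r`, hence zero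
  flux, at `b`; the sink `g(r) < 0` would then force a positive flux to the right of `b`.
-/

namespace SemiWave

/-! ### Weak derivatives -/

/-- The class `C_0^∞(I)` of test functions. -/
structure IsTestFunction (I : Set ℝ) (ψ : ℝ → ℝ) : Prop where
  contDiff : ContDiff ℝ ∞ ψ
  hasCompactSupport : HasCompactSupport ψ
  tsupport_subset : tsupport ψ ⊆ I

/-- The function `v` is the distributional derivative of `u` in `I`. -/
def HasWeakDerivOn (u v : ℝ → ℝ) (I : Set ℝ) : Prop :=
  ∀ ψ, IsTestFunction I ψ → ∫ x in I, u x * deriv ψ x = -∫ x in I, v x * ψ x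

section WeakDerivative

variable {I : Set ℝ} {u u' v v' ψ : ℝ → ℝ}

theorem hasDerivAt_integral_of_continuousOn (hI : IsOpen I) (hc : I.OrdConnected)
    (hv : ContinuousOn v I) {x₀ x : ℝ} (hx₀ : x₀ ∈ I) (hx : x ∈ I) :
    HasDerivAt (fun y => ∫ t in x₀..y, v t) (v x) x :=
  intervalIntegral.integral_hasDerivAt_right
    (hv.mono (hc.uIcc_subset hx₀ hx)).intervalIntegrable
    (hv.stronglyMeasurableAtFilter hI x hx) (hv.continuousAt (hI.mem_nhds hx))

theorem exists_isCompact_ordConnected {K : Set ℝ} (hK : IsCompact K) (hI : I.OrdConnected)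
    (hKI : K ⊆ I) : ∃ J, IsCompact J ∧ J.OrdConnected ∧ K ⊆ J ∧ J ⊆ I := by
  rcases K.eq_empty_or_nonempty with rfl | hne
  · exact ⟨∅, isCompact_empty, ordConnected_empty, subset_rfl, empty_subset I⟩
  · exact ⟨Icc (sInf K) (sSup K), isCompact_Icc, ordConnected_Icc,
      hK.isBounded.subset_Icc_sInf_sSup, hI.out (hKI (hK.sInf_mem hne)) (hKI (hK.sSup_mem hne))⟩

namespace IsTestFunction

protected theorem continuous (hψ : IsTestFunction I ψ) : Continuous ψ := hψ.contDiff.continuous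

theorem eq_zero_of_notMem (hψ : IsTestFunction I ψ) {x : ℝ} (hx : x ∉ I) : ψ x = 0 :=
  image_eq_zero_of_notMem_tsupport fun h => hx (hψ.tsupport_subset h)

protected theorem integrable (hψ : IsTestFunction I ψ) : Integrable ψ :=
  hψ.continuous.integrable_of_hasCompactSupport hψ.hasCompactSupport

protected theorem deriv (hψ : IsTestFunction I ψ) : IsTestFunction I (deriv ψ) where
  contDiff := (contDiff_infty_iff_deriv.1 hψ.contDiff).2
  hasCompactSupport := hψ.hasCompactSupport.deriv
  tsupport_subset := (tsupport_deriv_subset (𝕜 := ℝ)).trans hψ.tsupport_subset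

protected theorem sub {χ : ℝ → ℝ} (hψ : IsTestFunction I ψ) (hχ : IsTestFunction I χ) :
    IsTestFunction I (ψ - χ) where
  contDiff := hψ.contDiff.sub hχ.contDiff
  hasCompactSupport := hψ.hasCompactSupport.sub hχ.hasCompactSupport
  tsupport_subset :=
    (tsupport_sub ψ χ).trans (union_subset hψ.tsupport_subset hχ.tsupport_subset)

protected theorem const_mul (hψ : IsTestFunction I ψ) (a : ℝ) :
    IsTestFunction I fun x => a * ψ x where
  contDiff := contDiff_const.mul hψ.contDiff
  hasCompactSupport := hψ.hasCompactSupport.mul_left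
  tsupport_subset := tsupport_mul_subset_right.trans hψ.tsupport_subset

theorem setIntegral_mul (hψ : IsTestFunction I ψ) (u : ℝ → ℝ) :
    ∫ x in I, u x * ψ x = ∫ x, u x * ψ x :=
  setIntegral_eq_integral_of_forall_compl_eq_zero fun x hx => by
    rw [hψ.eq_zero_of_notMem hx, mul_zero]

theorem integrable_mul (hψ : IsTestFunction I ψ) (hu : LocallyIntegrableOn u I) :
    Integrable fun x => u x * ψ x := by
  refine (integrableOn_iff_integrable_of_support_subset ?_).1
    ((hu.integrableOn_compact_subset hψ.tsupport_subset hψ.hasCompactSupport).mul_continuousOn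
      hψ.continuous.continuousOn hψ.hasCompactSupport)
  exact (Function.support_mul_subset_right u ψ).trans (subset_tsupport ψ)

theorem hasDerivAt_mul (hψ : IsTestFunction I ψ) (hu : ∀ x ∈ I, HasDerivAt u (v x) x) (x : ℝ) :
    HasDerivAt (fun x => u x * ψ x) (v x * ψ x + u x * deriv ψ x) x := by
  by_cases hx : x ∈ I
  · exact (hu x hx).mul ((hψ.contDiff.differentiable (by simp)) x).hasDerivAt
  · have hzero : (fun x => u x * ψ x) =ᶠ[𝓝 x] fun _ => 0 := by
      filter_upwards [notMem_tsupport_iff_eventuallyEq.1 fun h => hx (hψ.tsupport_subset h)]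
        with y hy
      simp only [hy, Pi.zero_apply, mul_zero]
    simpa [hψ.eq_zero_of_notMem hx, hψ.deriv.eq_zero_of_notMem hx] using
      (hasDerivAt_const x (0 : ℝ)).congr_of_eventuallyEq hzero

/-- The primitive vanishes to the left of the support because the function does, and to the right
of it because the integral does. -/
theorem exists_deriv_eq (hI : I.OrdConnected) (hψ : IsTestFunction I ψ) (h0 : ∫ x, ψ x = 0) :
    ∃ χ, IsTestFunction I χ ∧ deriv χ = ψ := by
  have hder (x : ℝ) : HasDerivAt (fun y => ∫ t in Iic y, ψ t) (ψ x) x := by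
    have hsum (y : ℝ) : ∫ t in Iic y, ψ t = (∫ t in Iic 0, ψ t) + ∫ t in (0 : ℝ)..y, ψ t := by
      rw [← intervalIntegral.integral_Iic_sub_Iic hψ.integrable.integrableOn
        hψ.integrable.integrableOn, add_sub_cancel]
    rw [funext hsum]
    exact (hasDerivAt_integral_of_continuousOn isOpen_univ ordConnected_univ
      hψ.continuous.continuousOn (mem_univ 0) (mem_univ x)).const_add _
  have hderiv : deriv (fun y => ∫ t in Iic y, ψ t) = ψ := funext fun x => (hder x).deriv
  obtain ⟨J, hJ, hJc, hψJ, hJI⟩ :=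
    exists_isCompact_ordConnected hψ.hasCompactSupport hI hψ.tsupport_subset
  have hsupport : Function.support (fun y => ∫ t in Iic y, ψ t) ⊆ J := by
    intro x hx
    obtain ⟨s, hsx, hs⟩ : ∃ s ≤ x, ψ s ≠ 0 := by
      by_contra! h
      exact hx (setIntegral_eq_zero_of_forall_eq_zero h)
    obtain ⟨t, hxt, ht⟩ : ∃ t ∉ Iic x, ψ t ≠ 0 := by
      by_contra! h
      exact hx ((setIntegral_eq_integral_of_forall_compl_eq_zero h).trans h0)
    exact hJc.out (hψJ (subset_tsupport ψ hs)) (hψJ (subset_tsupport ψ ht))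
      ⟨hsx, (not_le.1 hxt).le⟩
  have htsupport := closure_minimal hsupport hJ.isClosed
  refine ⟨_, ⟨contDiff_infty_iff_deriv.2 ⟨fun x => (hder x).differentiableAt, ?_⟩,
    hJ.of_isClosed_subset (isClosed_tsupport _) htsupport, htsupport.trans hJI⟩, hderiv⟩
  rw [hderiv]
  exact hψ.contDiff

end IsTestFunction

theorem exists_isTestFunction_integral_eq_one (hI : IsOpen I) (hne : I.Nonempty) :
    ∃ ρ, IsTestFunction I ρ ∧ ∫ x, ρ x = 1 := by
  obtain ⟨x₀, hx₀⟩ := hne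
  obtain ⟨ε, hε, hball⟩ := Metric.isOpen_iff.1 hI x₀ hx₀
  let B : ContDiffBump x₀ := ⟨ε / 4, ε / 2, by positivity, by linarith⟩
  refine ⟨B.normed volume, ⟨B.contDiff_normed, B.hasCompactSupport_normed, ?_⟩, B.integral_normed⟩
  rw [B.tsupport_normed_eq]
  exact (Metric.closedBall_subset_ball (half_lt_self hε)).trans hball

theorem hasWeakDerivOn_of_hasDerivAt (hI : IsOpen I) (hu : ∀ x ∈ I, HasDerivAt u (v x) x)
    (hv : ContinuousOn v I) : HasWeakDerivOn u v I := by
  intro ψ hψ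
  have hloc {w : ℝ → ℝ} (hw : ContinuousOn w I) : LocallyIntegrableOn w I :=
    hw.locallyIntegrableOn hI.measurableSet
  have hu' : LocallyIntegrableOn u I := hloc (HasDerivAt.continuousOn hu)
  have hvψ := hψ.integrable_mul (hloc hv)
  have huψ' := hψ.deriv.integrable_mul hu'
  have hsum := integral_eq_zero_of_hasDerivAt_of_integrable (hψ.hasDerivAt_mul hu)
    (hvψ.add huψ') (hψ.integrable_mul hu')
  rw [integral_add hvψ huψ'] at hsum
  rw [hψ.deriv.setIntegral_mul, hψ.setIntegral_mul]
  linarith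

namespace HasWeakDerivOn

theorem congr_ae (h : HasWeakDerivOn u v I) (hv : ∀ᵐ x ∂volume.restrict I, v x = v' x) :
    HasWeakDerivOn u v' I := fun ψ hψ => by
  rw [h ψ hψ]
  exact congrArg Neg.neg (integral_congr_ae (hv.mono fun x hx => congrArg (· * ψ x) hx))

protected theorem sub (h : HasWeakDerivOn u v I) (h' : HasWeakDerivOn u' v' I)
    (hu : LocallyIntegrableOn u I) (hu' : LocallyIntegrableOn u' I)
    (hv : LocallyIntegrableOn v I) (hv' : LocallyIntegrableOn v' I) :
    HasWeakDerivOn (u - u') (v - v') I := fun ψ hψ => by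
  simp only [Pi.sub_apply, sub_mul]
  rw [integral_sub (hψ.deriv.integrable_mul hu).integrableOn
      (hψ.deriv.integrable_mul hu').integrableOn,
    integral_sub (hψ.integrable_mul hv).integrableOn (hψ.integrable_mul hv').integrableOn,
    h ψ hψ, h' ψ hψ]
  ring

/-- For a fixed `ρ` of integral one, `ψ - (∫ ψ) ρ` is the derivative of a test function, so `u`
integrates `ψ` to `∫ u ρ` times `∫ ψ`. -/
theorem exists_ae_eq_const (h : HasWeakDerivOn u 0 I) (hI : IsOpen I) (hc : I.OrdConnected)
    (hu : LocallyIntegrableOn u I) : ∃ K, ∀ᵐ x ∂volume.restrict I, u x = K := by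
  rcases I.eq_empty_or_nonempty with rfl | hne
  · simp
  obtain ⟨ρ, hρ, hρ1⟩ := exists_isTestFunction_integral_eq_one hI hne
  set K := ∫ x, u x * ρ x with hK
  have hzero : ∀ᵐ x, x ∈ I → u x - K = 0 := by
    refine hI.ae_eq_zero_of_integral_contDiff_smul_eq_zero
      (hu.sub (continuousOn_const.locallyIntegrableOn hI.measurableSet))
      fun ψ hψ hψc hψs => ?_
    have hψI : IsTestFunction I ψ := ⟨hψ, hψc, hψs⟩
    have hmean : ∫ x, (ψ x - (∫ y, ψ y) * ρ x) = 0 := by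
      rw [integral_sub hψI.integrable (hρ.integrable.const_mul _), integral_const_mul, hρ1]
      ring
    obtain ⟨χ, hχ, hχ'⟩ := (hψI.sub (hρ.const_mul (∫ y, ψ y))).exists_deriv_eq hc hmean
    have hsub : ∫ x, (u x * ψ x - (∫ y, ψ y) * (u x * ρ x)) = 0 := by
      have huχ := h χ hχ
      rw [hχ.deriv.setIntegral_mul, hχ'] at huχ
      simpa [mul_sub, mul_left_comm] using huχ
    rw [integral_sub (hψI.integrable_mul hu) ((hρ.integrable_mul hu).const_mul _),
      integral_const_mul, ← hK] at hsub
    calc ∫ x, ψ x • (u x - K) = ∫ x, (u x * ψ x - K * ψ x) := by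
          congr with x
          simp only [smul_eq_mul]
          ring
      _ = (∫ x, u x * ψ x) - (∫ y, ψ y) * K := by
          rw [integral_sub (hψI.integrable_mul hu) (hψI.integrable.const_mul K),
            integral_const_mul, mul_comm K]
      _ = 0 := hsub
  refine ⟨K, (ae_restrict_iff' hI.measurableSet).2 ?_⟩
  filter_upwards [hzero] with x hx hxI using sub_eq_zero.1 (hx hxI)

theorem exists_ae_eq_add_integral (h : HasWeakDerivOn u v I) (hI : IsOpen I) (hc : I.OrdConnected)
    (hu : LocallyIntegrableOn u I) (hv : ContinuousOn v I) {x₀ : ℝ} (hx₀ : x₀ ∈ I) :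
    ∃ K, ∀ᵐ x ∂volume.restrict I, u x = K + ∫ t in x₀..x, v t := by
  have hV (x : ℝ) (hx : x ∈ I) : HasDerivAt (fun y => ∫ t in x₀..y, v t) (v x) x :=
    hasDerivAt_integral_of_continuousOn hI hc hv hx₀ hx
  have hV_loc := (HasDerivAt.continuousOn hV).locallyIntegrableOn (μ := volume) hI.measurableSet
  have hv_loc := hv.locallyIntegrableOn (μ := volume) hI.measurableSet
  have hdiff := h.sub (hasWeakDerivOn_of_hasDerivAt hI hV hv) hu hV_loc hv_loc hv_loc
  rw [sub_self] at hdiff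
  obtain ⟨K, hK⟩ := hdiff.exists_ae_eq_const hI hc (hu.sub hV_loc)
  exact ⟨K, hK.mono fun x hx => sub_eq_iff_eq_add.1 hx⟩

theorem hasDerivAt (h : HasWeakDerivOn u v I) (hI : IsOpen I) (hc : I.OrdConnected)
    (hu : ContinuousOn u I) (hv : ContinuousOn v I) {x : ℝ} (hx : x ∈ I) :
    HasDerivAt u (v x) x := by
  have hV (y : ℝ) (hy : y ∈ I) : HasDerivAt (fun y => ∫ t in x..y, v t) (v y) y :=
    hasDerivAt_integral_of_continuousOn hI hc hv hx hy
  obtain ⟨K, hK⟩ := h.exists_ae_eq_add_integral hI hc (hu.locallyIntegrableOn hI.measurableSet)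
    hv hx
  have hEq := Measure.eqOn_open_of_ae_eq hK hI hu
    (continuousOn_const.add (HasDerivAt.continuousOn hV))
  exact ((hV x hx).const_add K).congr_of_eventuallyEq (hEq.eventuallyEq_of_mem (hI.mem_nhds hx))

end HasWeakDerivOn

end WeakDerivative

/-! ### Comparison, limits of solutions and global existence -/

section OrdinaryDifferentialEquations

/-- Argue on the interval from the last point where `u ≤ v` to a point where `v < u`: there
`u - v` is decreasing. -/
theorem le_of_deriv_le_of_lt {u u' v v' : ℝ → ℝ} {a b s : ℝ} (hu : ContinuousOn u (Icc a b))
    (hv : ContinuousOn v (Icc a b)) (hu' : ∀ t ∈ Ioo a b, HasDerivAt u (u' t) t)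
    (hv' : ∀ t ∈ Ioo a b, HasDerivAt v (v' t) t) (ha : u a ≤ v a)
    (h : ∀ t ∈ Ioo a b, v t < u t → u' t ≤ v' t) (hs : s ∈ Icc a b) : u s ≤ v s := by
  by_contra! hlt
  have hsub : Icc a s ⊆ Icc a b := Icc_subset_Icc_right hs.2
  have hcompact : IsCompact (Icc a s ∩ (u - v) ⁻¹' Iic 0) :=
    isCompact_Icc.of_isClosed_subset (((hu.sub hv).mono hsub).preimage_isClosed_of_isClosed
      isClosed_Icc isClosed_Iic) inter_subset_left
  obtain ⟨t, ⟨⟨hat, hts⟩, hut⟩, hmax⟩ :=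
    hcompact.exists_isGreatest ⟨a, ⟨le_rfl, hs.1⟩, sub_nonpos.2 ha⟩
  have hmem (x : ℝ) (hx : x ∈ Ioo t s) : x ∈ Ioo a b :=
    ⟨hat.trans_lt hx.1, hx.2.trans_le hs.2⟩
  have hgt (x : ℝ) (hx : x ∈ Ioo t s) : v x < u x := by
    by_contra! hle
    exact hx.1.not_ge (hmax ⟨⟨hat.trans hx.1.le, hx.2.le⟩, sub_nonpos.2 hle⟩)
  have hanti : AntitoneOn (u - v) (Icc t s) := by
    refine antitoneOn_of_hasDerivWithinAt_nonpos (f' := u' - v') (convex_Icc t s)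
      ((hu.sub hv).mono (Icc_subset_Icc hat hs.2)) ?_ ?_ <;> rw [interior_Icc] <;> intro x hx
    · exact ((hu' x (hmem x hx)).sub (hv' x (hmem x hx))).hasDerivWithinAt
    · exact sub_nonpos.2 (h x (hmem x hx) (hgt x hx))
  exact hlt.not_ge (sub_nonpos.1 ((hanti ⟨le_rfl, hts⟩ ⟨hts, le_rfl⟩ hts).trans hut))

theorem hasDerivAt_of_eventually_ne {F F' : ℝ → ℝ} {x : ℝ}
    (h : ∀ᶠ y in 𝓝[≠] x, HasDerivAt F (F' y) y) (hF : ContinuousAt F x)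
    (hF' : ContinuousAt F' x) : HasDerivAt F (F' x) x := by
  have hright : HasDerivWithinAt F (F' x) (Ici x) x := by
    have hev : ∀ᶠ y in 𝓝[>] x, HasDerivAt F (F' y) y :=
      h.filter_mono (nhdsWithin_mono _ fun _ hy => ne_of_gt hy)
    exact hasDerivWithinAt_Ici_of_tendsto_deriv (s := {y | HasDerivAt F (F' y) y})
      (fun y hy => HasDerivAt.differentiableAt hy |>.differentiableWithinAt)
      hF.continuousWithinAt hev
      (hF'.continuousWithinAt.tendsto.congr' (hev.mono fun y hy => hy.deriv.symm))
  have hleft : HasDerivWithinAt F (F' x) (Iic x) x := by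
    have hev : ∀ᶠ y in 𝓝[<] x, HasDerivAt F (F' y) y :=
      h.filter_mono (nhdsWithin_mono _ fun _ hy => ne_of_lt hy)
    exact hasDerivWithinAt_Iic_of_tendsto_deriv (s := {y | HasDerivAt F (F' y) y})
      (fun y hy => HasDerivAt.differentiableAt hy |>.differentiableWithinAt)
      hF.continuousWithinAt hev
      (hF'.continuousWithinAt.tendsto.congr' (hev.mono fun y hy => hy.deriv.symm))
  simpa using hleft.union hright

section Limits

variable {f f' : ℕ → ℝ → ℝ} {g g' : ℝ → ℝ} {I : Set ℝ} {C : ℝ}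

theorem continuousOn_of_tendsto_of_abs_deriv_le (hI : I.OrdConnected)
    (hf : ∀ n, ∀ x ∈ I, HasDerivAt (f n) (f' n x) x) (hC : ∀ n, ∀ x ∈ I, |f' n x| ≤ C)
    (hg : ∀ x ∈ I, Tendsto (fun n => f n x) atTop (𝓝 (g x))) : ContinuousOn g I := by
  refine LipschitzOnWith.continuousOn (K := C.toNNReal)
    (LipschitzOnWith.of_dist_le_mul fun x hx y hy => ?_)
  refine le_of_tendsto ((hg x hx).dist (hg y hy)) (Eventually.of_forall fun n => ?_)
  have hlip : LipschitzOnWith C.toNNReal (f n) I :=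
    hI.convex.lipschitzOnWith_of_nnnorm_hasDerivWithin_le
      (fun z hz => (hf n z hz).hasDerivWithinAt) fun z hz =>
        NNReal.coe_le_coe.1 ((hC n z hz).trans (Real.le_coe_toNNReal C))
  exact hlip.dist_le_mul x hx y hy

theorem hasDerivAt_of_tendsto_of_abs_deriv_le (hIo : IsOpen I) (hI : I.OrdConnected)
    (hf : ∀ n, ∀ x ∈ I, HasDerivAt (f n) (f' n x) x) (hf' : ∀ n, ContinuousOn (f' n) I)
    (hC : ∀ n, ∀ x ∈ I, |f' n x| ≤ C) (hg : ∀ x ∈ I, Tendsto (fun n => f n x) atTop (𝓝 (g x)))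
    (hg' : ∀ x ∈ I, Tendsto (fun n => f' n x) atTop (𝓝 (g' x))) (hg'c : ContinuousOn g' I)
    {x : ℝ} (hx : x ∈ I) : HasDerivAt g (g' x) x := by
  have hint (y : ℝ) (hy : y ∈ I) : g y = g x + ∫ t in x..y, g' t := by
    have hsub : uIcc x y ⊆ I := hI.uIcc_subset hx hy
    have hlim : Tendsto (fun n => ∫ t in x..y, f' n t) atTop (𝓝 (∫ t in x..y, g' t)) :=
      intervalIntegral.tendsto_integral_filter_of_dominated_convergence (fun _ => C)
        (Eventually.of_forall fun n => ((hf' n).mono (uIoc_subset_uIcc.trans hsub))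
          |>.aestronglyMeasurable measurableSet_uIoc)
        (Eventually.of_forall fun n => Eventually.of_forall fun t ht =>
          hC n t (hsub (uIoc_subset_uIcc ht)))
        intervalIntegrable_const
        (Eventually.of_forall fun t ht => hg' t (hsub (uIoc_subset_uIcc ht)))
    have hftc (n : ℕ) : ∫ t in x..y, f' n t = f n y - f n x :=
      intervalIntegral.integral_eq_sub_of_hasDerivAt (fun t ht => hf n t (hsub ht))
        ((hf' n).mono hsub).intervalIntegrable
    simp only [hftc] at hlim
    rw [← tendsto_nhds_unique ((hg y hy).sub (hg x hx)) hlim, add_sub_cancel]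
  exact ((hasDerivAt_integral_of_continuousOn hIo hI hg'c hx hx).const_add (g x))
    |>.congr_of_eventuallyEq (eventually_of_mem (hIo.mem_nhds hx) hint)

end Limits

theorem exists_hasDerivAt_of_lipschitzWith {E : Type*} [NormedAddCommGroup E] [NormedSpace ℝ E]
    [CompleteSpace E] {F : ℝ → E → E} {a b C : ℝ} {K : NNReal} (hab : a ≤ b) (x₀ : E)
    (hlip : ∀ t ∈ Icc a b, LipschitzWith K (F t))
    (hcont : ∀ x, ContinuousOn (fun t => F t x) (Icc a b))
    (hC : ∀ t ∈ Icc a b, ∀ x, ‖F t x‖ ≤ C) :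
    ∃ z : ℝ → E, z a = x₀ ∧ ContinuousOn z (Icc a b) ∧
      ∀ t ∈ Ioo a b, HasDerivAt z (F t (z t)) t := by
  have hC0 : 0 ≤ C := (norm_nonneg _).trans (hC a ⟨le_rfl, hab⟩ x₀)
  have hF : IsPicardLindelof F (tmin := a) (tmax := b) ⟨a, le_rfl, hab⟩ x₀
      ⟨C * (b - a), mul_nonneg hC0 (sub_nonneg.2 hab)⟩ 0 ⟨C, hC0⟩ K := by
    refine ⟨fun t ht => (hlip t ht).lipschitzOnWith, fun x _ => hcont x,
      fun t ht x _ => hC t ht x, ?_⟩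
    change C * max (b - a) (a - a) ≤ C * (b - a) - 0
    simp [hab]
  obtain ⟨z, hz₀, hz⟩ := hF.exists_eq_forall_mem_Icc_hasDerivWithinAt₀
  exact ⟨z, hz₀, fun t ht => (hz t ht).continuousWithinAt, fun t ht =>
    (hz t (Ioo_subset_Icc_self ht)).hasDerivAt (Icc_mem_nhds ht.1 ht.2)⟩

end OrdinaryDifferentialEquations

/-! ### The singular first-order problem -/

/-- A positive solution of the singular problem `z' = k + q / z` in `(0, r)`, `z(0) = 0`. The flux
`D(φ) φ'` of a profile, as a function of `φ`, solves it with `k = h - c` and `q = -D g`. -/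
structure IsFirstOrderSol (r : ℝ) (k q z : ℝ → ℝ) : Prop where
  zero : z 0 = 0
  continuousOn : ContinuousOn z (Ico 0 r)
  pos : ∀ s ∈ Ioo 0 r, 0 < z s
  hasDerivAt : ∀ s ∈ Ioo 0 r, HasDerivAt z (k s + q s / z s) s
  bddAbove : ∃ B, ∀ s ∈ Ioo 0 r, z s ≤ B

/-- A solution of the first-order problem regularised by `ε > 0`. When `|k| ≤ M`, the term `M ε`
makes the constant `ε` a lower solution. -/
structure IsRegularisedSol (r M : ℝ) (k q : ℝ → ℝ) (ε : ℝ) (z : ℝ → ℝ) : Prop where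
  zero : z 0 = ε
  continuousOn : ContinuousOn z (Icc 0 r)
  le : ∀ s ∈ Icc 0 r, ε ≤ z s
  hasDerivAt : ∀ s ∈ Ioo 0 r, HasDerivAt z (k s + (q s + M * ε) / z s) s

section FirstOrderProblem

variable {r M Q ε : ℝ} {k q z : ℝ → ℝ}

theorem lipschitzWith_div_max {a A : ℝ} (hε : 0 < ε) (ha : |a| ≤ A) :
    LipschitzWith (A / (ε * ε)).toNNReal fun x => a / max x ε := by
  have hmax (x : ℝ) : 0 < max x ε := lt_max_of_lt_right hε
  refine LipschitzWith.of_dist_le_mul fun x y => ?_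
  rw [Real.dist_eq, Real.dist_eq, Real.coe_toNNReal _
    (div_nonneg ((abs_nonneg a).trans ha) (mul_self_nonneg ε)),
    div_sub_div _ _ (hmax x).ne' (hmax y).ne', mul_comm _ a, ← mul_sub, abs_div, abs_mul,
    abs_of_pos (mul_pos (hmax x) (hmax y)), div_mul_eq_mul_div]
  have hsub : |max y ε - max x ε| ≤ |x - y| := by
    rw [abs_sub_comm x y]
    exact abs_max_sub_max_le_abs y x ε
  have hA : 0 ≤ A := (abs_nonneg a).trans ha
  gcongr <;> exact le_max_right _ _

/-- The vector field is truncated below the level `ε`, which the solution never crosses. -/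
theorem exists_isRegularisedSol (hr : 0 ≤ r) (hk : ContinuousOn k (Icc 0 r))
    (hq : ContinuousOn q (Icc 0 r)) (hkM : ∀ s ∈ Icc 0 r, |k s| ≤ M)
    (hq0 : ∀ s ∈ Icc 0 r, 0 ≤ q s) (hqQ : ∀ s ∈ Icc 0 r, q s ≤ Q) (hε : 0 < ε) :
    ∃ z, IsRegularisedSol r M k q ε z := by
  have hmax (x : ℝ) : 0 < max x ε := lt_max_of_lt_right hε
  have hMε : 0 ≤ M * ε := mul_nonneg ((abs_nonneg _).trans (hkM 0 ⟨le_rfl, hr⟩)) hε.le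
  have hnum (s : ℝ) (hs : s ∈ Icc 0 r) : |q s + M * ε| ≤ Q + M * ε := by
    rw [abs_of_nonneg (add_nonneg (hq0 s hs) hMε)]
    linarith [hqQ s hs]
  have hbound (s : ℝ) (hs : s ∈ Icc 0 r) (x : ℝ) :
      ‖k s + (q s + M * ε) / max x ε‖ ≤ M + (Q + M * ε) / ε := by
    refine (abs_add_le _ _).trans (add_le_add (hkM s hs) ?_)
    rw [abs_div, abs_of_pos (hmax x)]
    exact div_le_div₀ ((abs_nonneg _).trans (hnum s hs)) (hnum s hs) hε (le_max_right _ _)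
  obtain ⟨z, hz0, hzc, hz⟩ := exists_hasDerivAt_of_lipschitzWith
    (F := fun s x => k s + (q s + M * ε) / max x ε) hr ε
    (fun s hs => LipschitzWith.of_dist_le_mul fun x y => by
      rw [dist_add_left]
      exact (lipschitzWith_div_max hε (hnum s hs)).dist_le_mul x y)
    (fun x => hk.add ((hq.add continuousOn_const).div_const (max x ε))) hbound
  have hle (s : ℝ) (hs : s ∈ Icc 0 r) : ε ≤ z s := by
    refine le_of_deriv_le_of_lt (u := fun _ => ε) (u' := fun _ => 0) continuousOn_const hzc
      (fun t _ => hasDerivAt_const t ε) hz hz0.ge (fun t ht hlt => ?_) hs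
    have htI := Ioo_subset_Icc_self ht
    rw [max_eq_right hlt.le, add_div, mul_div_cancel_right₀ M hε.ne']
    linarith [(abs_le.1 (hkM t htI)).1, div_nonneg (hq0 t htI) hε.le]
  refine ⟨z, hz0, hzc, hle, fun s hs => ?_⟩
  simpa only [max_eq_left (hle s (Ioo_subset_Icc_self hs))] using hz s hs

namespace IsRegularisedSol

variable {ε' : ℝ} {z' : ℝ → ℝ}

theorem le_of_le (hz : IsRegularisedSol r M k q ε z) (hz' : IsRegularisedSol r M k q ε' z')
    (hM : 0 ≤ M) (hq0 : ∀ s ∈ Icc 0 r, 0 ≤ q s) (hε : 0 < ε) (hεε' : ε ≤ ε') {s : ℝ}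
    (hs : s ∈ Icc 0 r) : z s ≤ z' s := by
  refine le_of_deriv_le_of_lt hz.continuousOn hz'.continuousOn hz.hasDerivAt hz'.hasDerivAt
    (by rwa [hz.zero, hz'.zero]) (fun t ht hlt => ?_) hs
  have htI := Ioo_subset_Icc_self ht
  have hz't : 0 < z' t := (hε.trans_le hεε').trans_le (hz'.le t htI)
  have hnum : 0 ≤ q t + M * ε' := add_nonneg (hq0 t htI) (mul_nonneg hM (hε.trans_le hεε').le)
  gcongr

theorem le_one_add_mul (hz : IsRegularisedSol r M k q ε z) (hkM : ∀ s ∈ Icc 0 r, |k s| ≤ M)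
    (hq0 : ∀ s ∈ Icc 0 r, 0 ≤ q s) (hqQ : ∀ s ∈ Icc 0 r, q s ≤ Q) (hε : 0 < ε) (hε1 : ε ≤ 1)
    {s : ℝ} (hs : s ∈ Icc 0 r) : z s ≤ 1 + (2 * M + Q) * s := by
  refine le_of_deriv_le_of_lt (v := fun s => 1 + (2 * M + Q) * s) (v' := fun _ => 2 * M + Q)
    hz.continuousOn (by fun_prop) hz.hasDerivAt
    (fun t _ => by simpa using ((hasDerivAt_id t).const_mul (2 * M + Q)).const_add 1)
    (by simpa [hz.zero]) (fun t ht hlt => ?_) hs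
  have htI := Ioo_subset_Icc_self ht
  have hM : 0 ≤ M := (abs_nonneg _).trans (hkM t htI)
  have hQ : 0 ≤ Q := (hq0 t htI).trans (hqQ t htI)
  have hzt : 1 ≤ z t := by
    have : 0 ≤ (2 * M + Q) * t := mul_nonneg (by positivity) ht.1.le
    linarith
  have hdiv : (q t + M * ε) / z t ≤ Q + M := by
    refine (div_le_self (add_nonneg (hq0 t htI) (mul_nonneg hM hε.le)) hzt).trans ?_
    linarith [hqQ t htI, mul_le_of_le_one_right hM hε1]
  linarith [(abs_le.1 (hkM t htI)).2]

theorem mul_sub_le (hz : IsRegularisedSol r M k q ε z) (hkM : ∀ s ∈ Icc 0 r, |k s| ≤ M)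
    (hε : 0 < ε) {a b δ : ℝ} (ha : 0 ≤ a) (hb : b ≤ r) (hδ : 0 ≤ δ) (hδ1 : δ ≤ 1)
    (hδq : ∀ s ∈ Ioo a b, (1 + M) * (δ * r) ≤ q s) {s : ℝ} (hs : s ∈ Icc a b) :
    δ * (s - a) ≤ z s := by
  have hsub : Icc a b ⊆ Icc 0 r := Icc_subset_Icc ha hb
  have hpos (t : ℝ) (ht : t ∈ Icc a b) : 0 < z t := hε.trans_le (hz.le t (hsub ht))
  refine le_of_deriv_le_of_lt (u := fun s => δ * (s - a)) (u' := fun _ => δ) (by fun_prop)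
    (hz.continuousOn.mono hsub)
    (fun t _ => by simpa using ((hasDerivAt_id t).sub_const a).const_mul δ)
    (fun t ht => hz.hasDerivAt t (Ioo_subset_Ioo ha hb ht))
    (by simpa using (hpos a ⟨le_rfl, hs.1.trans hs.2⟩).le) (fun t ht hlt => ?_) hs
  have htI := hsub (Ioo_subset_Icc_self ht)
  have hzt : 0 < z t := hpos t (Ioo_subset_Icc_self ht)
  have hM : 0 ≤ M := (abs_nonneg _).trans (hkM t htI)
  have hztr : z t ≤ δ * r :=
    hlt.le.trans (mul_le_mul_of_nonneg_left (by linarith [htI.2]) hδ)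
  have hdiv : 1 + M ≤ (q t + M * ε) / z t := by
    rw [le_div_iff₀ hzt]
    calc (1 + M) * z t ≤ (1 + M) * (δ * r) := by gcongr
      _ ≤ q t := hδq t ht
      _ ≤ q t + M * ε := le_add_of_nonneg_right (mul_nonneg hM hε.le)
  linarith [(abs_le.1 (hkM t htI)).1]

theorem exists_pos_le (hr : 0 < r) (hkM : ∀ s ∈ Icc 0 r, |k s| ≤ M)
    (hq : ContinuousOn q (Icc 0 r)) (hqpos : ∀ s ∈ Ioo 0 r, 0 < q s) {a b : ℝ} (ha : 0 < a)
    (hb : b < r) :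
    ∃ m > 0, ∀ ε > 0, ∀ z, IsRegularisedSol r M k q ε z → ∀ s ∈ Icc a b, m ≤ z s := by
  have hsub : Icc (a / 2) b ⊆ Ioo 0 r := fun s hs =>
    ⟨(half_pos ha).trans_le hs.1, hs.2.trans_lt hb⟩
  have hM : 0 ≤ M := (abs_nonneg _).trans (hkM 0 ⟨le_rfl, hr.le⟩)
  obtain ⟨q₀, hq₀, hle⟩ : ∃ q₀ > 0, ∀ s ∈ Icc (a / 2) b, q₀ ≤ q s :=
    isCompact_Icc.exists_forall_le' (hq.mono (hsub.trans Ioo_subset_Icc_self))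
      fun s hs => hqpos s (hsub hs)
  set δ : ℝ := min 1 (q₀ / ((1 + M) * r))
  have hδ : 0 < δ := lt_min one_pos (by positivity)
  have hδq : (1 + M) * (δ * r) ≤ q₀ := by
    rw [mul_left_comm]
    exact (le_div_iff₀ (by positivity)).1 (min_le_right _ _)
  refine ⟨δ * (a / 2), by positivity, fun ε hε z hz s hs => ?_⟩
  calc δ * (a / 2) ≤ δ * (s - a / 2) := by
        have := hs.1
        gcongr
        linarith
    _ ≤ z s := hz.mul_sub_le hkM hε (half_pos ha).le hb.le hδ.le (min_le_left _ _)
        (fun t ht => hδq.trans (hle t (Ioo_subset_Icc_self ht))) ⟨by linarith [hs.1], hs.2⟩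

end IsRegularisedSol

section VanishingRegularisation

variable {e : ℕ → ℝ} {Z : ℕ → ℝ → ℝ}

theorem hasDerivAt_of_tendsto_regularisedSol (hr : 0 < r) (hk : ContinuousOn k (Icc 0 r))
    (hq : ContinuousOn q (Icc 0 r)) (hkM : ∀ s ∈ Icc 0 r, |k s| ≤ M)
    (hqQ : ∀ s ∈ Icc 0 r, q s ≤ Q) (hqpos : ∀ s ∈ Ioo 0 r, 0 < q s) (he : ∀ n, 0 < e n)
    (he1 : ∀ n, e n ≤ 1) (hlim : Tendsto e atTop (𝓝 0))
    (hZ : ∀ n, IsRegularisedSol r M k q (e n) (Z n))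
    (hz : ∀ s ∈ Ioo 0 r, Tendsto (fun n => Z n s) atTop (𝓝 (z s))) {s : ℝ} (hs : s ∈ Ioo 0 r) :
    0 < z s ∧ HasDerivAt z (k s + q s / z s) s := by
  obtain ⟨a, ha, has⟩ := exists_between hs.1
  obtain ⟨b, hsb, hb⟩ := exists_between hs.2
  have hsub : Ioo a b ⊆ Ioo 0 r := Ioo_subset_Ioo ha.le hb.le
  have hsub' : Ioo a b ⊆ Icc 0 r := hsub.trans Ioo_subset_Icc_self
  have hM : 0 ≤ M := (abs_nonneg _).trans (hkM 0 ⟨le_rfl, hr.le⟩)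
  obtain ⟨m, hm, hmZ⟩ := IsRegularisedSol.exists_pos_le hr hkM hq hqpos ha hb
  have hmz (t : ℝ) (ht : t ∈ Ioo a b) : m ≤ z t :=
    ge_of_tendsto' (hz t (hsub ht)) fun n => hmZ _ (he n) _ (hZ n) t (Ioo_subset_Icc_self ht)
  have hZpos (n : ℕ) (t : ℝ) (ht : t ∈ Ioo a b) : 0 < Z n t :=
    (he n).trans_le ((hZ n).le t (hsub' ht))
  have hbound (n : ℕ) (t : ℝ) (ht : t ∈ Ioo a b) :
      |k t + (q t + M * e n) / Z n t| ≤ M + (Q + M) / m := by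
    have hqt := hqpos t (hsub ht)
    have hnum : 0 ≤ q t + M * e n := add_nonneg hqt.le (mul_nonneg hM (he n).le)
    refine (abs_add_le _ _).trans (add_le_add (hkM t (hsub' ht)) ?_)
    rw [abs_of_nonneg (div_nonneg hnum (hZpos n t ht).le)]
    have hle : q t + M * e n ≤ Q + M := by
      linarith [hqQ t (hsub' ht), mul_le_of_le_one_right hM (he1 n)]
    exact div_le_div₀ (hnum.trans hle) hle hm (hmZ _ (he n) _ (hZ n) t (Ioo_subset_Icc_self ht))
  have hder (n : ℕ) (t : ℝ) (ht : t ∈ Ioo a b) := (hZ n).hasDerivAt t (hsub ht)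
  have hkc := hk.mono hsub'
  have hqc := hq.mono hsub'
  have hzc : ContinuousOn z (Ioo a b) := continuousOn_of_tendsto_of_abs_deriv_le
    ordConnected_Ioo hder hbound fun t ht => hz t (hsub ht)
  refine ⟨hm.trans_le (hmz s ⟨has, hsb⟩), hasDerivAt_of_tendsto_of_abs_deriv_le isOpen_Ioo
    ordConnected_Ioo hder (fun n => hkc.add ((hqc.add continuousOn_const).div
      ((hZ n).continuousOn.mono hsub') fun t ht => (hZpos n t ht).ne')) hbound
    (fun t ht => hz t (hsub ht)) (g' := fun t => k t + q t / z t) (fun t ht => ?_)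
    (hkc.add (hqc.div hzc fun t ht => (hm.trans_le (hmz t ht)).ne')) ⟨has, hsb⟩⟩
  simpa using ((((hlim.const_mul M).const_add (q t)).div (hz t (hsub ht))
    (hm.trans_le (hmz t ht)).ne').const_add (k t))

theorem continuousWithinAt_zero_of_le_regularisedSol (hr : 0 ≤ r)
    (hlim : Tendsto e atTop (𝓝 0)) (hZ : ∀ n, IsRegularisedSol r M k q (e n) (Z n))
    (hz0 : z 0 = 0) (hznonneg : ∀ s ∈ Icc 0 r, 0 ≤ z s)
    (hzle : ∀ n, ∀ s ∈ Icc 0 r, z s ≤ Z n s) : ContinuousWithinAt z (Icc 0 r) 0 := by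
  rw [ContinuousWithinAt, hz0]
  refine tendsto_order.2 ⟨fun l hl => ?_, fun l hl => ?_⟩
  · filter_upwards [self_mem_nhdsWithin] with s hs using hl.trans_le (hznonneg s hs)
  · obtain ⟨n, hn⟩ := (hlim.eventually (gt_mem_nhds hl)).exists
    have hZn := (hZ n).continuousOn 0 ⟨le_rfl, hr⟩
    rw [ContinuousWithinAt, (hZ n).zero] at hZn
    filter_upwards [self_mem_nhdsWithin, hZn.eventually (gt_mem_nhds hn)] with s hs hlt
      using (hzle n s hs).trans_lt hlt

end VanishingRegularisation

theorem exists_isFirstOrderSol (hr : 0 < r) (hk : ContinuousOn k (Icc 0 r))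
    (hq : ContinuousOn q (Icc 0 r)) (hq0 : ∀ s ∈ Icc 0 r, 0 ≤ q s)
    (hqpos : ∀ s ∈ Ioo 0 r, 0 < q s) : ∃ z, IsFirstOrderSol r k q z := by
  obtain ⟨M, hkM⟩ := isCompact_Icc.exists_bound_of_continuousOn hk
  obtain ⟨Q, hqQ⟩ := isCompact_Icc.bddAbove_image hq
  replace hqQ (s : ℝ) (hs : s ∈ Icc 0 r) : q s ≤ Q := hqQ (mem_image_of_mem q hs)
  have h0 : (0 : ℝ) ∈ Icc 0 r := ⟨le_rfl, hr.le⟩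
  have hM : 0 ≤ M := (norm_nonneg _).trans (hkM 0 h0)
  have hQ : 0 ≤ Q := (hq0 0 h0).trans (hqQ 0 h0)
  let e : ℕ → ℝ := fun n => 1 / ((n : ℝ) + 1)
  have he (n : ℕ) : 0 < e n := Nat.one_div_pos_of_nat
  have hanti : Antitone e := fun m n hmn => Nat.one_div_le_one_div hmn
  have he1 (n : ℕ) : e n ≤ 1 := (hanti n.zero_le).trans_eq (by simp [e])
  have hlim : Tendsto e atTop (𝓝 0) := tendsto_one_div_add_atTop_nhds_zero_nat
  choose Z hZ using fun n => exists_isRegularisedSol hr.le hk hq hkM hq0 hqQ (he n)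
  have hZnonneg (s : ℝ) (hs : s ∈ Icc 0 r) (n : ℕ) : 0 ≤ Z n s :=
    (he n).le.trans ((hZ n).le s hs)
  have hbdd (s : ℝ) (hs : s ∈ Icc 0 r) : BddBelow (range fun n => Z n s) :=
    ⟨0, forall_mem_range.2 (hZnonneg s hs)⟩
  have hZlim (s : ℝ) (hs : s ∈ Icc 0 r) : Tendsto (fun n => Z n s) atTop (𝓝 (⨅ n, Z n s)) :=
    tendsto_atTop_ciInf (fun m n hmn => (hZ n).le_of_le (hZ m) hM hq0 (he n) (hanti hmn) hs)
      (hbdd s hs)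
  have hz0 : ⨅ n, Z n 0 = 0 :=
    tendsto_nhds_unique (hZlim 0 h0) (by simpa only [(hZ _).zero] using hlim)
  have hzle (n : ℕ) (s : ℝ) (hs : s ∈ Icc 0 r) : ⨅ n, Z n s ≤ Z n s := ciInf_le (hbdd s hs) n
  have hsol (s : ℝ) (hs : s ∈ Ioo 0 r) := hasDerivAt_of_tendsto_regularisedSol
    (z := fun s => ⨅ n, Z n s) hr hk hq hkM hqQ hqpos he he1 hlim hZ
    (fun t ht => hZlim t (Ioo_subset_Icc_self ht)) hs
  refine ⟨fun s => ⨅ n, Z n s, hz0, fun s hs => ?_, fun s hs => (hsol s hs).1,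
    fun s hs => (hsol s hs).2, 1 + (2 * M + Q) * r, fun s hs => ?_⟩
  · rcases hs.1.eq_or_lt with rfl | hs0
    · exact (continuousWithinAt_zero_of_le_regularisedSol hr.le hlim hZ hz0
        (fun s hs => le_ciInf (hZnonneg s hs)) hzle).mono Ico_subset_Icc_self
    · exact (hsol s ⟨hs0, hs.2⟩).2.continuousAt.continuousWithinAt
  · have hsI := Ioo_subset_Icc_self hs
    refine ((hzle 0 s hsI).trans ((hZ 0).le_one_add_mul hkM hq0 hqQ (he 0) (he1 0) hsI)).trans ?_
    have := hs.2.le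
    gcongr

end FirstOrderProblem

/-! ### Inverting the travel time -/

/-- The inverse of an increasing function `T` on `(0, r)`, extended by `0` to the left of the range
of `T`. The supremum is taken in `[0, r]`, so that monotonicity comes for free. -/
noncomputable def extendedInverse (r : ℝ) (T : ℝ → ℝ) (ξ : ℝ) : ℝ :=
  sSup (insert 0 {s ∈ Ioo 0 r | T s ≤ ξ})

section ExtendedInverse

variable {r ξ : ℝ} {T : ℝ → ℝ}

theorem bddAbove_sublevel (hr : 0 ≤ r) (ξ : ℝ) : BddAbove (insert 0 {s ∈ Ioo 0 r | T s ≤ ξ}) :=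
  ⟨r, forall_mem_insert.2 ⟨hr, fun _ hs => hs.1.2.le⟩⟩

theorem extendedInverse_nonneg (hr : 0 ≤ r) (ξ : ℝ) : 0 ≤ extendedInverse r T ξ :=
  le_csSup (bddAbove_sublevel hr ξ) (mem_insert 0 _)

theorem monotone_extendedInverse (hr : 0 ≤ r) : Monotone (extendedInverse r T) := fun _ η h =>
  csSup_le_csSup (bddAbove_sublevel hr η) (insert_nonempty _ _)
    (insert_subset_insert fun _ hs => ⟨hs.1, hs.2.trans h⟩)

theorem extendedInverse_apply (hT : StrictMonoOn T (Ioo 0 r)) {s : ℝ} (hs : s ∈ Ioo 0 r) :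
    extendedInverse r T (T s) = s :=
  IsGreatest.csSup_eq ⟨mem_insert_of_mem _ ⟨hs, le_rfl⟩,
    forall_mem_insert.2 ⟨hs.1.le, fun _ ht => (hT.le_iff_le ht.1 hs).1 ht.2⟩⟩

theorem extendedInverse_le (hT : StrictMonoOn T (Ioo 0 r)) {s : ℝ} (hs : s ∈ Ioo 0 r)
    (h : ξ ≤ T s) : extendedInverse r T ξ ≤ s :=
  (monotone_extendedInverse (hs.1.trans hs.2).le h).trans_eq (extendedInverse_apply hT hs)

theorem extendedInverse_mem_Ico (hT : StrictMonoOn T (Ioo 0 r)) (hξ : ∃ s ∈ Ioo 0 r, ξ < T s) :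
    extendedInverse r T ξ ∈ Ico 0 r := by
  obtain ⟨s, hs, h⟩ := hξ
  exact ⟨extendedInverse_nonneg (hs.1.trans hs.2).le ξ,
    (extendedInverse_le hT hs h.le).trans_lt hs.2⟩

theorem apply_extendedInverse (hT : StrictMonoOn T (Ioo 0 r)) (hTc : ContinuousOn T (Ioo 0 r))
    (hξ : ∃ s ∈ Ioo 0 r, ξ < T s) (hpos : 0 < extendedInverse r T ξ) :
    T (extendedInverse r T ξ) = ξ := by
  obtain ⟨t, ht, hξt⟩ := hξ
  obtain ⟨s, hs, hs_pos⟩ := exists_lt_of_lt_csSup (insert_nonempty _ _) hpos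
  obtain ⟨hs, hsξ⟩ : s ∈ {s ∈ Ioo 0 r | T s ≤ ξ} := hs.resolve_left hs_pos.ne'
  obtain ⟨u, hu, rfl⟩ := (isPreconnected_Ioo.image T hTc).ordConnected.out
    (mem_image_of_mem T hs) (mem_image_of_mem T ht) ⟨hsξ, hξt.le⟩
  rw [extendedInverse_apply hT hu]

theorem tendsto_extendedInverse_zero (hr : 0 < r) (hT : StrictMonoOn T (Ioo 0 r)) {l : Filter ℝ}
    (hl : ∀ s ∈ Ioo 0 r, ∀ᶠ ξ in l, ξ < T s) : Tendsto (extendedInverse r T) l (𝓝 0) := by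
  refine tendsto_order.2 ⟨fun a ha => Eventually.of_forall fun ξ =>
    ha.trans_le (extendedInverse_nonneg hr.le ξ), fun a ha => ?_⟩
  obtain ⟨s, hs_pos, hs⟩ := exists_between (lt_min ha hr)
  have hs_mem : s ∈ Ioo 0 r := ⟨hs_pos, hs.trans_le (min_le_right a r)⟩
  filter_upwards [hl s hs_mem] with ξ hξ
  exact (extendedInverse_le hT hs_mem hξ.le).trans_lt (hs.trans_le (min_le_left a r))

theorem continuousAt_extendedInverse (hT : StrictMonoOn T (Ioo 0 r))
    (hξ : ∃ s ∈ Ioo 0 r, ξ < T s) : ContinuousAt (extendedInverse r T) ξ := by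
  obtain ⟨h_nonneg, h_lt⟩ := extendedInverse_mem_Ico hT hξ
  have hr : 0 < r := h_nonneg.trans_lt h_lt
  rcases h_nonneg.eq_or_lt with hzero | hpos
  · rw [ContinuousAt, ← hzero]
    refine tendsto_extendedInverse_zero hr hT fun s hs => Iio_mem_nhds ?_
    by_contra! hle
    exact hs.1.not_ge (hzero ▸ (extendedInverse_apply hT hs).symm.trans_le
      (monotone_extendedInverse hr.le hle))
  · refine continuousAt_of_monotoneOn_of_image_mem_nhds
      ((monotone_extendedInverse hr.le).monotoneOn univ) univ_mem ?_
    filter_upwards [Ioo_mem_nhds hpos h_lt] with s hs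
    exact ⟨T s, mem_univ _, extendedInverse_apply hT hs⟩

end ExtendedInverse

/-- `φ` is the increasing solution of `φ' = z(φ) / D(φ)` in `(-∞, b)` that takes all values in
`(0, r)`, extended by zero if it vanishes at a finite point. The travel time `T`, a primitive of
`D / z`, is its inverse. -/
structure IsProfile (r : ℝ) (D z T : ℝ → ℝ) (b : ℝ) (φ : ℝ → ℝ) : Prop where
  hasDerivAt_time : ∀ s ∈ Ioo 0 r, HasDerivAt T (D s / z s) s
  time_lt : ∀ s ∈ Ioo 0 r, T s < b
  apply_time : ∀ s ∈ Ioo 0 r, φ (T s) = s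
  mem_Ico : ∀ ξ < b, φ ξ ∈ Ico 0 r
  continuousAt : ∀ ξ < b, ContinuousAt φ ξ
  monotoneOn : MonotoneOn φ (Iio b)
  hasDerivAt : ∀ ξ < b, 0 < φ ξ → HasDerivAt φ (z (φ ξ) / D (φ ξ)) ξ
  tendsto : Tendsto φ atBot (𝓝 0)

section Existence

variable {r : ℝ} {D z T : ℝ → ℝ}

theorem strictMonoOn_time (hD : DHat r D) (hz : ∀ s ∈ Ioo 0 r, 0 < z s)
    (hT : ∀ s ∈ Ioo 0 r, HasDerivAt T (D s / z s) s) : StrictMonoOn T (Ioo 0 r) := by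
  refine strictMonoOn_of_deriv_pos (convex_Ioo 0 r)
    (fun s hs => (hT s hs).continuousAt.continuousWithinAt) fun s hs => ?_
  rw [interior_Ioo] at hs
  rw [(hT s hs).deriv]
  exact div_pos (hD s hs) (hz s hs)

theorem exists_isProfile_of_bddAbove (hr : 0 < r) (hD : DHat r D) (hz : ∀ s ∈ Ioo 0 r, 0 < z s)
    (hT : ∀ s ∈ Ioo 0 r, HasDerivAt T (D s / z s) s) (hTb : BddAbove (T '' Ioo 0 r)) :
    ∃ b φ, IsProfile r D z T b φ := by
  have hTc : ContinuousOn T (Ioo 0 r) := fun s hs => (hT s hs).continuousAt.continuousWithinAt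
  have hTm : StrictMonoOn T (Ioo 0 r) := strictMonoOn_time hD hz hT
  have h_range {ξ : ℝ} (hξ : ξ < sSup (T '' Ioo 0 r)) : ∃ s ∈ Ioo 0 r, ξ < T s := by
    simpa only [exists_mem_image] using
      exists_lt_of_lt_csSup ((nonempty_Ioo.2 hr).image T) hξ
  have hcont (ξ : ℝ) (hξ : ξ < sSup (T '' Ioo 0 r)) : ContinuousAt (extendedInverse r T) ξ :=
    continuousAt_extendedInverse hTm (h_range hξ)
  refine ⟨sSup (T '' Ioo 0 r), extendedInverse r T, hT, fun s hs => ?_,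
    fun s hs => extendedInverse_apply hTm hs, fun ξ hξ => extendedInverse_mem_Ico hTm (h_range hξ),
    hcont, (monotone_extendedInverse hr.le).monotoneOn _, fun ξ hξ hpos => ?_,
    tendsto_extendedInverse_zero hr hTm fun s _ => Iio_mem_atBot (T s)⟩
  · obtain ⟨t, hst, htr⟩ := exists_between hs.2
    have ht : t ∈ Ioo 0 r := ⟨hs.1.trans hst, htr⟩
    exact (hTm hs ht hst).trans_le (le_csSup hTb (mem_image_of_mem T ht))
  · have hmem : extendedInverse r T ξ ∈ Ioo 0 r :=
      ⟨hpos, (extendedInverse_mem_Ico hTm (h_range hξ)).2⟩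
    rw [← inv_div]
    refine (hT _ hmem).of_local_left_inverse (hcont ξ hξ) (div_pos (hD _ hmem) (hz _ hmem)).ne' ?_
    filter_upwards [Iio_mem_nhds hξ, (hcont ξ hξ).eventually (lt_mem_nhds hpos)] with η hη hη_pos
    exact apply_extendedInverse hTm hTc (h_range hη) hη_pos

theorem IsFirstOrderSol.antitoneOn_mul_time_sub {k q : ℝ → ℝ} {s₀ γ M : ℝ}
    (hz : IsFirstOrderSol r k q z) (hT : ∀ s ∈ Ioo 0 r, HasDerivAt T (D s / z s) s)
    (hs₀ : 0 < s₀) (hγ : ∀ s ∈ Ioo s₀ r, γ * D s ≤ q s) (hM : ∀ s ∈ Ioo s₀ r, -M ≤ k s) :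
    AntitoneOn (fun s => γ * T s - (z s + M * s)) (Ico s₀ r) := by
  have hsub : Ico s₀ r ⊆ Ioo 0 r := Ico_subset_Ioo_left hs₀
  have hder (s : ℝ) (hs : s ∈ Ico s₀ r) : HasDerivAt (fun s => γ * T s - (z s + M * s))
      (γ * (D s / z s) - (k s + q s / z s + M * 1)) s :=
    ((hT s (hsub hs)).const_mul γ).sub
      ((hz.hasDerivAt s (hsub hs)).add ((hasDerivAt_id s).const_mul M))
  refine antitoneOn_of_hasDerivWithinAt_nonpos (convex_Ico s₀ r)
    (fun s hs => (hder s hs).continuousAt.continuousWithinAt)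
    (fun s hs => (hder s (interior_subset hs)).hasDerivWithinAt) fun s hs => ?_
  rw [interior_Ico] at hs
  have hzs : 0 < z s := hz.pos s (hsub (Ioo_subset_Ico_self hs))
  have hdiv : γ * D s / z s ≤ q s / z s := div_le_div_of_nonneg_right (hγ s hs) hzs.le
  rw [← mul_div_assoc]
  linarith [hM s hs]

/-- The flux `z` is bounded, so the travel time up to `r` is finite: the wave reaches the value `r`
at a finite point. -/
theorem IsFirstOrderSol.bddAbove_time {k q : ℝ → ℝ} {s₀ γ M : ℝ} (hz : IsFirstOrderSol r k q z)
    (hD : DHat r D) (hT : ∀ s ∈ Ioo 0 r, HasDerivAt T (D s / z s) s) (hs₀ : s₀ ∈ Ioo 0 r)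
    (hγ_pos : 0 < γ) (hγ : ∀ s ∈ Ioo s₀ r, γ * D s ≤ q s) (hM : ∀ s ∈ Ioo 0 r, |k s| ≤ M) :
    BddAbove (T '' Ioo 0 r) := by
  obtain ⟨B, hB⟩ := hz.bddAbove
  have hM_nonneg : 0 ≤ M := (abs_nonneg _).trans (hM s₀ hs₀)
  have hanti := hz.antitoneOn_mul_time_sub hT hs₀.1 hγ fun s hs =>
    neg_le_of_abs_le (hM s ⟨hs₀.1.trans hs.1, hs.2⟩)
  refine ⟨(γ * T s₀ + B + M * r) / γ, forall_mem_image.2 fun s hs => ?_⟩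
  rw [le_div_iff₀' hγ_pos]
  have hzs : z s ≤ B := hB s hs
  have hMs : M * s ≤ M * r := mul_le_mul_of_nonneg_left hs.2.le hM_nonneg
  rcases le_total s s₀ with hle | hle
  · have hTs : γ * T s ≤ γ * T s₀ := mul_le_mul_of_nonneg_left
      ((strictMonoOn_time hD hz.pos hT).monotoneOn hs hs₀ hle) hγ_pos.le
    linarith [hz.pos s hs, mul_nonneg hM_nonneg hs.1.le]
  · have hcomp : γ * T s - (z s + M * s) ≤ γ * T s₀ - (z s₀ + M * s₀) :=
      hanti ⟨le_rfl, hs₀.2⟩ ⟨hle, hs.2⟩ hle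
    linarith [hz.pos s₀ hs₀, mul_nonneg hM_nonneg hs₀.1.le]

end Existence

/-! ### Monotone functions that leave zero -/

section ZeroSet

variable {b : ℝ} {φ : ℝ → ℝ}

theorem pos_or_exists_zero_set (h_nonneg : ∀ ξ < b, 0 ≤ φ ξ)
    (hcont : ∀ ξ < b, ContinuousAt φ ξ) (hmono : MonotoneOn φ (Iio b)) (hpos : ∃ ξ < b, 0 < φ ξ) :
    (∀ ξ < b, 0 < φ ξ) ∨ ∃ A < b, (∀ ξ ≤ A, φ ξ = 0) ∧ ∀ ξ ∈ Ioo A b, 0 < φ ξ := by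
  by_cases! h : ∀ ξ < b, 0 < φ ξ
  · exact Or.inl h
  obtain ⟨ξ₀, hξ₀b, hξ₀⟩ := h
  obtain ⟨ξ₁, hξ₁b, hξ₁⟩ := hpos
  set Z : Set ℝ := {ξ | ξ < b ∧ φ ξ ≤ 0}
  have hZ_ne : Z.Nonempty := ⟨ξ₀, hξ₀b, hξ₀⟩
  have hZ_le : ∀ ξ ∈ Z, ξ ≤ ξ₁ := fun ξ hξ =>
    (hmono.reflect_lt hξ.1 hξ₁b (hξ.2.trans_lt hξ₁)).le
  have hAb : sSup Z < b := (csSup_le hZ_ne hZ_le).trans_lt hξ₁b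
  have h_left : ∀ ξ < sSup Z, φ ξ = 0 := fun ξ hξ => by
    obtain ⟨η, hη, hξη⟩ := exists_lt_of_lt_csSup hZ_ne hξ
    exact le_antisymm ((hmono (hξη.trans hη.1) hη.1 hξη.le).trans hη.2) (h_nonneg ξ (hξ.trans hAb))
  have h_lim : Tendsto φ (𝓝[<] (sSup Z)) (𝓝 (φ (sSup Z))) := (hcont _ hAb).continuousWithinAt
  have h_sup : φ (sSup Z) = 0 :=
    tendsto_nhds_unique h_lim <| tendsto_const_nhds.congr' <| by
      filter_upwards [self_mem_nhdsWithin] with ξ hξ using (h_left ξ hξ).symm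
  refine Or.inr ⟨sSup Z, hAb, fun ξ hξ => ?_, fun ξ hξ => ?_⟩
  · rcases hξ.eq_or_lt with rfl | hlt
    exacts [h_sup, h_left ξ hlt]
  · by_contra! hle
    exact hξ.1.not_ge (le_csSup ⟨ξ₁, hZ_le⟩ ⟨hξ.2, hle⟩)

theorem deriv_eq_zero_of_eq_zero_left {ξ : ℝ} (h : ∀ η ≤ ξ, φ η = 0) : deriv φ ξ = 0 := by
  by_cases hd : DifferentiableAt ℝ φ ξ
  · refine (uniqueDiffWithinAt_Iic ξ).eq_deriv _ hd.hasDerivAt.hasDerivWithinAt ?_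
    exact (hasDerivWithinAt_const ξ (Iic ξ) (0 : ℝ)).congr (fun η hη => h η hη) (h ξ le_rfl)
  · exact deriv_zero_of_not_differentiableAt hd

end ZeroSet

/-! ### Calculus along a profile -/

namespace IsProfile

variable {r b ξ : ℝ} {D z T φ : ℝ → ℝ}

theorem exists_pos (hr : 0 < r) (hφ : IsProfile r D z T b φ) : ∃ ξ < b, 0 < φ ξ := by
  obtain ⟨s, hs⟩ := nonempty_Ioo.2 hr
  exact ⟨T s, hφ.time_lt s hs, hs.1.trans_eq (hφ.apply_time s hs).symm⟩

theorem pos_or_exists (hr : 0 < r) (hφ : IsProfile r D z T b φ) :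
    (∀ ξ < b, 0 < φ ξ) ∨ ∃ A < b, (∀ ξ ≤ A, φ ξ = 0) ∧ ∀ ξ ∈ Ioo A b, 0 < φ ξ :=
  pos_or_exists_zero_set (fun ξ hξ => (hφ.mem_Ico ξ hξ).1) hφ.continuousAt hφ.monotoneOn
    (hφ.exists_pos hr)

theorem eq_zero_of_le (hφ : IsProfile r D z T b φ) (hξ : ξ < b) (hzero : φ ξ = 0) {η : ℝ}
    (hη : η ≤ ξ) : φ η = 0 :=
  le_antisymm ((hφ.monotoneOn (hη.trans_lt hξ) hξ hη).trans_eq hzero)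
    (hφ.mem_Ico η (hη.trans_lt hξ)).1

theorem continuousOn_comp (hφ : IsProfile r D z T b φ) {F : ℝ → ℝ}
    (hF : ContinuousOn F (Ico 0 r)) : ContinuousOn (fun ξ => F (φ ξ)) (Iio b) :=
  hF.comp (fun ξ hξ => (hφ.continuousAt ξ hξ).continuousWithinAt) hφ.mem_Ico

theorem eventuallyEq_zero_or_pos (hr : 0 < r) (hφ : IsProfile r D z T b φ) :
    ∃ A, ∀ ξ < b, ξ ≠ A → φ =ᶠ[𝓝 ξ] 0 ∨ 0 < φ ξ := by
  rcases hφ.pos_or_exists hr with hpos | ⟨A, -, hzero, hpos⟩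
  · exact ⟨0, fun ξ hξ _ => Or.inr (hpos ξ hξ)⟩
  · refine ⟨A, fun ξ hξ hne => hne.lt_or_gt.imp (fun hlt => ?_) fun hgt => hpos ξ ⟨hgt, hξ⟩⟩
    filter_upwards [Iio_mem_nhds hlt] with η hη using hzero η (le_of_lt hη)

theorem exists_differentiableAt_of_ne (hr : 0 < r) (hφ : IsProfile r D z T b φ) :
    ∃ A, ∀ ξ < b, ξ ≠ A → DifferentiableAt ℝ φ ξ := by
  obtain ⟨A, hA⟩ := hφ.eventuallyEq_zero_or_pos hr
  refine ⟨A, fun ξ hξ hne => ?_⟩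
  rcases hA ξ hξ hne with hzero | hpos
  · exact (differentiableAt_const (0 : ℝ)).congr_of_eventuallyEq hzero
  · exact (hφ.hasDerivAt ξ hξ hpos).differentiableAt

/-- The point where `φ` leaves zero, at which `φ` need not be differentiable, is reached by a
limit. -/
theorem hasDerivAt_comp (hr : 0 < r) (hφ : IsProfile r D z T b φ) {F F' G : ℝ → ℝ}
    (hF : ContinuousOn F (Ico 0 r)) (hG : ContinuousOn G (Ico 0 r)) (hG_zero : G 0 = 0)
    (hF' : ∀ s ∈ Ioo 0 r, HasDerivAt F (F' s) s)
    (hFG : ∀ s ∈ Ioo 0 r, F' s * (z s / D s) = G s) (hξ : ξ < b) :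
    HasDerivAt (fun ξ => F (φ ξ)) (G (φ ξ)) ξ := by
  obtain ⟨A, hA⟩ := hφ.eventuallyEq_zero_or_pos hr
  refine hasDerivAt_of_eventually_ne (F' := fun ξ => G (φ ξ)) ?_
    ((hφ.continuousOn_comp hF).continuousAt (Iio_mem_nhds hξ))
    ((hφ.continuousOn_comp hG).continuousAt (Iio_mem_nhds hξ))
  have hne : ∀ᶠ η in 𝓝[≠] ξ, η ≠ A := by
    rcases eq_or_ne ξ A with rfl | hne
    exacts [self_mem_nhdsWithin, mem_nhdsWithin_of_mem_nhds (isOpen_ne.mem_nhds hne)]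
  filter_upwards [hne, mem_nhdsWithin_of_mem_nhds (Iio_mem_nhds hξ)] with η hηA hηb
  rcases hA η hηb hηA with hzero | hpos
  · rw [hzero.self_of_nhds, Pi.zero_apply, hG_zero]
    exact (hasDerivAt_const η (F 0)).congr_of_eventuallyEq (hzero.fun_comp F)
  · have hmem : φ η ∈ Ioo 0 r := ⟨hpos, (hφ.mem_Ico η hηb).2⟩
    rw [← hFG _ hmem]
    exact (hF' _ hmem).comp η (hφ.hasDerivAt η hηb hpos)

theorem diffFlux_eq (hD : DHat r D) (hz : z 0 = 0) (hφ : IsProfile r D z T b φ) (hξ : ξ < b) :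
    diffFlux D φ ξ = z (φ ξ) := by
  rcases (hφ.mem_Ico ξ hξ).1.eq_or_lt with hzero | hpos
  · rw [diffFlux, deriv_eq_zero_of_eq_zero_left fun η hη => hφ.eq_zero_of_le hξ hzero.symm hη,
      ← hzero, hz, mul_zero]
  · rw [diffFlux, (hφ.hasDerivAt ξ hξ hpos).deriv,
      mul_div_cancel₀ _ (hD _ ⟨hpos, (hφ.mem_Ico ξ hξ).2⟩).ne']

end IsProfile

/-! ### Admissible data -/

/-- The hypotheses of the theorem on the data of the equation: regularity, positivity of `D` in
`(0, r)`, negativity of `g` in `(0, r]`, and `g 0 = 0`. -/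
structure IsAdmissible (r : ℝ) (f D g : ℝ → ℝ) : Prop where
  pos : 0 < r
  data : IsData r f D g
  D_pos : DHat r D
  g_neg : GHat r g

/-- The coefficient `h - c` of the first-order problem. -/
noncomputable def rate (r : ℝ) (f : ℝ → ℝ) (c s : ℝ) : ℝ := dot r f s - c

/-- The coefficient `-D g` of the first-order problem. -/
def reaction (D g : ℝ → ℝ) (s : ℝ) : ℝ := -(D s * g s)

/-- The first-order problem `z' = h - c - D g / z`, `z(0) = 0` solved by the flux `D(φ) φ'` of a
profile, as a function of `φ`. -/
def IsFluxSol (r : ℝ) (f D g : ℝ → ℝ) (c : ℝ) (z : ℝ → ℝ) : Prop :=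
  IsFirstOrderSol r (rate r f c) (reaction D g) z

namespace IsAdmissible

variable {r c s : ℝ} {f D g : ℝ → ℝ}

theorem continuousOn_D (h : IsAdmissible r f D g) : ContinuousOn D (Icc 0 r) :=
  h.data.D_contDiffOn.continuousOn

theorem hasDerivWithinAt_f (h : IsAdmissible r f D g) (hs : s ∈ Icc 0 r) :
    HasDerivWithinAt f (dot r f s) (Icc 0 r) s :=
  (h.data.f_contDiffOn.differentiableOn one_ne_zero s hs).hasDerivWithinAt

theorem hasDerivAt_f (h : IsAdmissible r f D g) (hs : s ∈ Ioo 0 r) :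
    HasDerivAt f (dot r f s) s :=
  (h.hasDerivWithinAt_f (Ioo_subset_Icc_self hs)).hasDerivAt (Icc_mem_nhds hs.1 hs.2)

theorem continuousOn_rate (h : IsAdmissible r f D g) : ContinuousOn (rate r f c) (Icc 0 r) :=
  (h.data.f_contDiffOn.continuousOn_derivWithin (uniqueDiffOn_Icc h.pos) le_rfl).sub
    continuousOn_const

theorem continuousOn_reaction (h : IsAdmissible r f D g) :
    ContinuousOn (reaction D g) (Icc 0 r) :=
  (h.continuousOn_D.mul h.data.g_continuousOn).neg

theorem D_nonneg (h : IsAdmissible r f D g) (hs : s ∈ Icc 0 r) : 0 ≤ D s := by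
  rw [← closure_Ioo h.pos.ne] at hs
  have hcont : ContinuousOn D (closure (Ioo 0 r)) := by
    rw [closure_Ioo h.pos.ne]
    exact h.continuousOn_D
  exact closure_minimal (image_subset_iff.2 fun t ht => (h.D_pos t ht).le) isClosed_Ici
    (hcont.image_closure (mem_image_of_mem D hs))

theorem g_nonpos (h : IsAdmissible r f D g) (hs : s ∈ Icc 0 r) : g s ≤ 0 := by
  rcases hs.1.eq_or_lt with rfl | hpos
  exacts [h.g_neg.2.le, (h.g_neg.1 s ⟨hpos, hs.2⟩).le]

theorem reaction_pos (h : IsAdmissible r f D g) (hs : s ∈ Ioo 0 r) : 0 < reaction D g s :=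
  neg_pos.2 (mul_neg_of_pos_of_neg (h.D_pos s hs) (h.g_neg.1 s ⟨hs.1, hs.2.le⟩))

theorem exists_isFluxSol (h : IsAdmissible r f D g) (c : ℝ) : ∃ z, IsFluxSol r f D g c z :=
  exists_isFirstOrderSol h.pos h.continuousOn_rate h.continuousOn_reaction
    (fun _ hs => neg_nonneg.2 (mul_nonpos_of_nonneg_of_nonpos (h.D_nonneg hs) (h.g_nonpos hs)))
    fun _ hs => h.reaction_pos hs

theorem bddAbove_time (h : IsAdmissible r f D g) {z T : ℝ → ℝ} (hz : IsFluxSol r f D g c z)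
    (hT : ∀ s ∈ Ioo 0 r, HasDerivAt T (D s / z s) s) : BddAbove (T '' Ioo 0 r) := by
  have hmid : r / 2 ∈ Ioo 0 r := ⟨half_pos h.pos, half_lt_self h.pos⟩
  obtain ⟨M, hM⟩ := isCompact_Icc.exists_bound_of_continuousOn (h.continuousOn_rate (c := c))
  obtain ⟨s₁, hs₁, hs₁_max⟩ := (isCompact_Icc (a := r / 2) (b := r)).exists_isMaxOn
    (nonempty_Icc.2 hmid.2.le) (h.data.g_continuousOn.mono (Icc_subset_Icc_left hmid.1.le))
  refine hz.bddAbove_time h.D_pos hT hmid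
    (neg_pos.2 (h.g_neg.1 s₁ ⟨hmid.1.trans_le hs₁.1, hs₁.2⟩)) (fun s hs => ?_)
    fun s hs => hM s (Ioo_subset_Icc_self hs)
  rw [reaction, neg_mul, neg_le_neg_iff, mul_comm (g s₁)]
  exact mul_le_mul_of_nonneg_left (hs₁_max (Ioo_subset_Icc_self hs))
    (h.D_pos s ⟨hmid.1.trans hs.1, hs.2⟩).le

theorem exists_isProfile (h : IsAdmissible r f D g) {z : ℝ → ℝ} (hz : IsFluxSol r f D g c z) :
    ∃ T b φ, IsProfile r D z T b φ := by
  have hcont : ContinuousOn (fun s => D s / z s) (Ioo 0 r) :=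
    (h.continuousOn_D.mono Ioo_subset_Icc_self).div (hz.continuousOn.mono Ioo_subset_Ico_self)
      fun s hs => (hz.pos s hs).ne'
  have hT : ∀ s ∈ Ioo 0 r, HasDerivAt (fun s => ∫ t in (r / 2)..s, D t / z t) (D s / z s) s :=
    fun s hs => hasDerivAt_integral_of_continuousOn isOpen_Ioo ordConnected_Ioo hcont
      ⟨half_pos h.pos, half_lt_self h.pos⟩ hs
  exact ⟨_, exists_isProfile_of_bddAbove h.pos h.D_pos hz.pos hT (h.bddAbove_time hz hT)⟩

theorem hasStrictDerivAt_primitive_D (h : IsAdmissible r f D g) (hs : s ∈ Ioo 0 r) :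
    HasStrictDerivAt (fun x => ∫ t in (0 : ℝ)..x, D t) (D s) s :=
  intervalIntegral.integral_hasStrictDerivAt_right
    ((h.continuousOn_D.mono (by
      rw [uIcc_of_le hs.1.le]
      exact Icc_subset_Icc_right hs.2.le)).intervalIntegrable)
    ((h.continuousOn_D.mono Ioo_subset_Icc_self).stronglyMeasurableAtFilter isOpen_Ioo s hs)
    (h.continuousOn_D.continuousAt (Icc_mem_nhds hs.1 hs.2))

theorem continuousOn_primitive_D (h : IsAdmissible r f D g) :
    ContinuousOn (fun x => ∫ t in (0 : ℝ)..x, D t) (Icc 0 r) := by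
  rw [← uIcc_of_le h.pos.le]
  refine intervalIntegral.continuousOn_primitive_interval ?_
  rw [uIcc_of_le h.pos.le]
  exact h.continuousOn_D.integrableOn_Icc

end IsAdmissible

/-! ### Profiles are semi-wavefronts -/

section AbsoluteContinuity

variable {F F' G : ℝ → ℝ} {a b : ℝ}

theorem absolutelyContinuousOnInterval_congr (hF : AbsolutelyContinuousOnInterval F a b)
    (h : EqOn F G (uIcc a b)) : AbsolutelyContinuousOnInterval G a b := by
  rw [absolutelyContinuousOnInterval_iff] at hF ⊢
  intro ε hε
  obtain ⟨δ, hδ, hlt⟩ := hF ε hε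
  refine ⟨δ, hδ, fun E hE hEδ => (Finset.sum_congr rfl fun i hi => ?_).trans_lt (hlt E hE hEδ)⟩
  rw [h (hE.1 i hi).1, h (hE.1 i hi).2]

theorem absolutelyContinuousOnInterval_of_hasDerivAt
    (hF : ∀ x ∈ uIcc a b, HasDerivAt F (F' x) x) (hF' : IntervalIntegrable F' volume a b) :
    AbsolutelyContinuousOnInterval F a b := by
  have hconst : AbsolutelyContinuousOnInterval (fun _ => F a) a b :=
    (LipschitzWith.const (F a)).lipschitzOnWith.absolutelyContinuousOnInterval
  refine absolutelyContinuousOnInterval_congr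
    (hconst.add (hF'.absolutelyContinuousOnInterval_intervalIntegral left_mem_uIcc))
    fun x hx => ?_
  have hsub : uIcc a x ⊆ uIcc a b := uIcc_subset_uIcc_left hx
  rw [Pi.add_apply, intervalIntegral.integral_eq_sub_of_hasDerivAt (fun t ht => hF t (hsub ht))
    (hF'.mono_set hsub), add_sub_cancel]

end AbsoluteContinuity

namespace IsProfile

variable {r b c ξ : ℝ} {f D g z T φ : ℝ → ℝ}

theorem continuousOn (hφ : IsProfile r D z T b φ) : ContinuousOn φ (Iio b) :=
  fun ξ hξ => (hφ.continuousAt ξ hξ).continuousWithinAt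

theorem mapsTo_Icc (hφ : IsProfile r D z T b φ) : MapsTo φ (Iio b) (Icc 0 r) :=
  fun ξ hξ => Ico_subset_Icc_self (hφ.mem_Ico ξ hξ)

theorem continuousOn_diffFlux (h : IsAdmissible r f D g) (hz : IsFluxSol r f D g c z)
    (hφ : IsProfile r D z T b φ) : ContinuousOn (diffFlux D φ) (Iio b) :=
  (hφ.continuousOn_comp hz.continuousOn).congr fun _ hξ => hφ.diffFlux_eq h.D_pos hz.zero hξ

theorem hasDerivAt_primitive_D (h : IsAdmissible r f D g) (hz : IsFluxSol r f D g c z)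
    (hφ : IsProfile r D z T b φ) (hξ : ξ < b) :
    HasDerivAt (fun ξ => ∫ s in (0 : ℝ)..φ ξ, D s) (diffFlux D φ ξ) ξ := by
  rw [hφ.diffFlux_eq h.D_pos hz.zero hξ]
  exact hφ.hasDerivAt_comp h.pos (h.continuousOn_primitive_D.mono Ico_subset_Icc_self)
    hz.continuousOn hz.zero (fun s hs => (h.hasStrictDerivAt_primitive_D hs).hasDerivAt)
    (fun s hs => mul_div_cancel₀ _ (h.D_pos s hs).ne') hξ

theorem hasDerivAt_flux (h : IsAdmissible r f D g) (hz : IsFluxSol r f D g c z)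
    (hφ : IsProfile r D z T b φ) (hξ : ξ < b) :
    HasDerivAt (fun ξ => diffFlux D φ ξ - f (φ ξ) + c * φ ξ) (-g (φ ξ)) ξ := by
  have hflux : HasDerivAt (fun ξ => z (φ ξ) - f (φ ξ) + c * φ ξ) (-g (φ ξ)) ξ := by
    refine hφ.hasDerivAt_comp h.pos (F := fun s => z s - f s + c * s)
      (F' := fun s => rate r f c s + reaction D g s / z s - dot r f s + c * 1)
      (G := fun s => -g s)
      ((hz.continuousOn.sub (h.data.f_contDiffOn.continuousOn.mono Ico_subset_Icc_self)).add
        (by fun_prop))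
      (h.data.g_continuousOn.mono Ico_subset_Icc_self).neg (by rw [h.g_neg.2, neg_zero])
      (fun s hs => ((hz.hasDerivAt s hs).sub (h.hasDerivAt_f hs)).add
        ((hasDerivAt_id s).const_mul c)) (fun s hs => ?_) hξ
    have hz_ne := (hz.pos s hs).ne'
    have hD_ne := (h.D_pos s hs).ne'
    simp only [rate, reaction]
    field_simp
    ring
  refine hflux.congr_of_eventuallyEq ?_
  filter_upwards [Iio_mem_nhds hξ] with η hη
  rw [hφ.diffFlux_eq h.D_pos hz.zero hη]

theorem isTravelingWave (h : IsAdmissible r f D g) (hz : IsFluxSol r f D g c z)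
    (hφ : IsProfile r D z T b φ) : IsTravelingWave r f D g c (Iio b) φ where
  isOpen := isOpen_Iio
  ordConnected := ordConnected_Iio
  mapsTo := hφ.mapsTo_Icc
  continuousOn := hφ.continuousOn
  ae_differentiableAt := by
    rw [ae_restrict_iff' measurableSet_Iio]
    obtain ⟨A, hA⟩ := hφ.exists_differentiableAt_of_ne h.pos
    filter_upwards [Measure.ae_ne volume A] with ξ hne hξ using hA ξ hξ hne
  locallyIntegrableOn := (hφ.continuousOn_diffFlux h hz).locallyIntegrableOn measurableSet_Iio
  weakDeriv ψ hψ hψc hψb := hasWeakDerivOn_of_hasDerivAt isOpen_Iio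
    (fun _ hξ => hφ.hasDerivAt_primitive_D h hz hξ) (hφ.continuousOn_diffFlux h hz) ψ ⟨hψ, hψc, hψb⟩
  weakEquation ψ hψ hψc hψb := by
    have hψ : IsTestFunction (Iio b) ψ := ⟨hψ, hψc, hψb⟩
    have hflux (ξ : ℝ) (hξ : ξ ∈ Iio b) := hφ.hasDerivAt_flux h hz hξ
    have hg : ContinuousOn (fun ξ => g (φ ξ)) (Iio b) :=
      hφ.continuousOn_comp (h.data.g_continuousOn.mono Ico_subset_Icc_self)
    rw [integral_sub
      (hψ.deriv.integrable_mul ((HasDerivAt.continuousOn hflux).locallyIntegrableOn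
        measurableSet_Iio)).integrableOn
      (hψ.integrable_mul (hg.locallyIntegrableOn measurableSet_Iio)).integrableOn,
      hasWeakDerivOn_of_hasDerivAt isOpen_Iio hflux hg.neg ψ hψ]
    simp only [neg_mul, integral_neg, neg_neg, sub_self]

theorem isSemiWavefrontFrom (h : IsAdmissible r f D g) (hz : IsFluxSol r f D g c z)
    (hφ : IsProfile r D z T b φ) : IsSemiWavefrontFrom r f D g c 0 b φ where
  isTravelingWave := hφ.isTravelingWave h hz
  mem_Icc := left_mem_Icc.2 h.pos.le
  g_eq_zero := h.g_neg.2
  monotonic := Or.inl hφ.monotoneOn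
  nonconstant := by
    rintro ⟨k, hk⟩
    have hval (s : ℝ) (hs : s ∈ Ioo 0 r) : s = k :=
      (hφ.apply_time s hs).symm.trans (hk _ (hφ.time_lt s hs))
    obtain ⟨s, hs⟩ := nonempty_Ioo.2 h.pos
    obtain ⟨t, ht⟩ := nonempty_Ioo.2 hs.1
    exact ht.2.ne ((hval t ⟨ht.1, ht.2.trans hs.2⟩).trans (hval s hs).symm)
  tendsto := hφ.tendsto

theorem hasDerivAt_diffFlux (h : IsAdmissible r f D g) (hz : IsFluxSol r f D g c z)
    (hφ : IsProfile r D z T b φ) (hξ : ξ < b) (hdiff : DifferentiableAt ℝ φ ξ) :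
    HasDerivAt (diffFlux D φ) (-g (φ ξ) + (dot r f (φ ξ) - c) * deriv φ ξ) ξ := by
  have hf : HasDerivAt (fun η => f (φ η)) (dot r f (φ ξ) * deriv φ ξ) ξ :=
    ((h.hasDerivWithinAt_f (hφ.mapsTo_Icc hξ)).comp ξ hdiff.hasDerivAt.hasDerivWithinAt
      hφ.mapsTo_Icc).hasDerivAt (Iio_mem_nhds hξ)
  refine (((hφ.hasDerivAt_flux h hz hξ).add hf).sub
    (hdiff.hasDerivAt.const_mul c)).congr_deriv (by ring) |>.congr_of_eventuallyEq
    (Eventually.of_forall fun η => ?_)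
  simp only [Pi.add_apply, Pi.sub_apply]
  ring

theorem intervalIntegrable_deriv_diffFlux (h : IsAdmissible r f D g)
    (hφ : IsProfile r D z T b φ) {x y : ℝ} (hsub : uIcc x y ⊆ Iio b) :
    IntervalIntegrable (fun ξ => -g (φ ξ) + (dot r f (φ ξ) - c) * deriv φ ξ) volume x y := by
  have hg : ContinuousOn (fun ξ => -g (φ ξ)) (uIcc x y) :=
    ((h.data.g_continuousOn.comp hφ.continuousOn hφ.mapsTo_Icc).mono hsub).neg
  have hrate : ContinuousOn (fun ξ => dot r f (φ ξ) - c) (uIcc x y) :=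
    (h.continuousOn_rate.comp hφ.continuousOn hφ.mapsTo_Icc).mono hsub
  exact hg.intervalIntegrable.add
    ((hφ.monotoneOn.mono hsub).intervalIntegrable_deriv.continuousOn_mul hrate)

theorem isClassicalOn (h : IsAdmissible r f D g) (hz : IsFluxSol r f D g c z)
    (hφ : IsProfile r D z T b φ) {U : Set ℝ} (hU : MeasurableSet U) (hUb : U ⊆ Iio b)
    (hdiff : ∀ ξ ∈ U, DifferentiableAt ℝ φ ξ) : IsClassicalOn r f D g c U φ where
  differentiableAt := hdiff
  absolutelyContinuous x y hxy hsub := by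
    rw [← uIcc_of_le hxy] at hsub
    exact absolutelyContinuousOnInterval_of_hasDerivAt
      (fun ξ hξ => hφ.hasDerivAt_diffFlux h hz (hUb (hsub hξ)) (hdiff ξ (hsub hξ)))
      (hφ.intervalIntegrable_deriv_diffFlux h (hsub.trans hUb))
  equation := by
    filter_upwards [ae_restrict_mem hU] with ξ hξ
    rw [(hφ.hasDerivAt_diffFlux h hz (hUb hξ) (hdiff ξ hξ)).deriv]
    ring

theorem isSharpAt (h : IsAdmissible r f D g) (hz : IsFluxSol r f D g c z)
    (hφ : IsProfile r D z T b φ) (hξ : ξ < b) (hndiff : ¬ DifferentiableAt ℝ φ ξ) :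
    IsSharpAt r f D g c (Iio b) φ 0 := by
  have hzero : φ ξ = 0 := by
    by_contra hne
    exact hndiff (hφ.hasDerivAt ξ hξ ((hφ.mem_Ico ξ hξ).1.lt_of_ne' hne)).differentiableAt
  obtain ⟨A, hA⟩ := hφ.exists_differentiableAt_of_ne h.pos
  obtain rfl : ξ = A := by
    by_contra hne
    exact hndiff (hA ξ hξ hne)
  exact ⟨h.g_neg.2, ξ, hξ, hzero, hφ.isClassicalOn h hz
    (measurableSet_Iio.diff (measurableSet_singleton ξ)) sdiff_subset
    (fun η hη => hA η hη.1 hη.2), hndiff⟩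

theorem isClassicalOrSharp (h : IsAdmissible r f D g) (hz : IsFluxSol r f D g c z)
    (hφ : IsProfile r D z T b φ) : IsClassicalOrSharp r f D g c (Iio b) φ := by
  by_cases! hdiff : ∀ ξ < b, DifferentiableAt ℝ φ ξ
  · exact Or.inl (hφ.isClassicalOn h hz measurableSet_Iio subset_rfl hdiff)
  · obtain ⟨ξ, hξ, hndiff⟩ := hdiff
    exact Or.inr ⟨0, hφ.isSharpAt h hz hξ hndiff⟩

theorem isClassicalOn_of_tendsto (h : IsAdmissible r f D g) (hz : IsFluxSol r f D g c z)
    (hφ : IsProfile r D z T b φ) (hlim : Tendsto (fun s => z s / D s) (𝓝[>] 0) (𝓝 0)) :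
    IsClassicalOn r f D g c (Iio b) φ := by
  refine hφ.isClassicalOn h hz measurableSet_Iio subset_rfl fun ξ hξ => ?_
  have hzero : z 0 / D 0 = 0 := by rw [hz.zero, zero_div]
  have hcont : ContinuousOn (fun s => z s / D s) (Ico 0 r) := by
    intro s hs
    rcases hs.1.eq_or_lt with rfl | hpos
    · exact (continuousWithinAt_Ioi_iff_Ici.1
        (by rwa [ContinuousWithinAt, hzero])).mono Ico_subset_Ici_self
    · exact (hz.continuousOn s hs).div
        (h.continuousOn_D.mono Ico_subset_Icc_self s hs) (h.D_pos s ⟨hpos, hs.2⟩).ne'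
  exact (hφ.hasDerivAt_comp h.pos (F := id) (F' := fun _ => 1) continuousOn_id hcont hzero
    (fun s _ => hasDerivAt_id s) (fun s _ => one_mul _) hξ).differentiableAt

theorem mul_sub_le_sub (hφ : IsProfile r D z T b φ) {κ s₀ x y : ℝ}
    (hκ : ∀ s ∈ Ioo 0 r, s < s₀ → κ ≤ z s / D s) (hxy : x ≤ y) (hy : y < b)
    (hpos : ∀ ξ ∈ Ioo x y, 0 < φ ξ) (hys : φ y < s₀) : κ * (y - x) ≤ φ y - φ x := by
  have hder (ξ : ℝ) (hξ : ξ ∈ Ioo x y) : HasDerivAt φ (z (φ ξ) / D (φ ξ)) ξ :=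
    hφ.hasDerivAt ξ (hξ.2.trans hy) (hpos ξ hξ)
  refine (convex_Icc x y).mul_sub_le_image_sub_of_le_deriv
    (hφ.continuousOn.mono fun ξ hξ => hξ.2.trans_lt hy) ?_ ?_ x (left_mem_Icc.2 hxy) y
    (right_mem_Icc.2 hxy) hxy
  · rw [interior_Icc]
    exact fun ξ hξ => (hder ξ hξ).differentiableAt.differentiableWithinAt
  · rw [interior_Icc]
    intro ξ hξ
    have hξb : ξ < b := hξ.2.trans hy
    rw [(hder ξ hξ).deriv]
    exact hκ _ ⟨hpos ξ hξ, (hφ.mem_Ico ξ hξb).2⟩ ((hφ.monotoneOn hξb hy hξ.2.le).trans_lt hys)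

theorem exists_nonpos_of_le (hφ : IsProfile r D z T b φ) {κ s₀ : ℝ} (hκ_pos : 0 < κ)
    (hs₀ : 0 < s₀) (hκ : ∀ s ∈ Ioo 0 r, s < s₀ → κ ≤ z s / D s) : ∃ ξ < b, φ ξ ≤ 0 := by
  by_contra! hpos
  obtain ⟨y, hys, hy⟩ :=
    ((hφ.tendsto.eventually (gt_mem_nhds hs₀)).and (Iio_mem_atBot b)).exists
  have hy : y < b := hy
  have hxy : y - φ y / κ < y := sub_lt_self y (div_pos (hpos y hy) hκ_pos)
  have hle := hφ.mul_sub_le_sub hκ hxy.le hy (fun ξ hξ => hpos ξ (hξ.2.trans hy)) hys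
  rw [sub_sub_cancel, mul_div_cancel₀ _ hκ_pos.ne'] at hle
  linarith [hpos _ (hxy.trans hy)]

theorem isSharpAt_of_le (h : IsAdmissible r f D g) (hz : IsFluxSol r f D g c z)
    (hφ : IsProfile r D z T b φ) {κ : ℝ} (hκ : 0 < κ) (hle : ∀ᶠ s in 𝓝[>] 0, κ * D s ≤ z s) :
    IsSharpAt r f D g c (Iio b) φ 0 := by
  obtain ⟨s₀, hs₀ : 0 < s₀, hs₀_le⟩ := mem_nhdsGT_iff_exists_Ioo_subset.1 hle
  have hslope (s : ℝ) (hs : s ∈ Ioo 0 r) (hlt : s < s₀) : κ ≤ z s / D s :=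
    (le_div_iff₀ (h.D_pos s hs)).2 (hs₀_le ⟨hs.1, hlt⟩)
  obtain ⟨ξ, hξ, hξ_le⟩ := hφ.exists_nonpos_of_le hκ hs₀ hslope
  rcases hφ.pos_or_exists h.pos with hpos | ⟨A, hA, hzero, hpos⟩
  · exact absurd (hpos ξ hξ) hξ_le.not_gt
  refine hφ.isSharpAt h hz hA fun hdiff => ?_
  have hslope_lt : ∀ᶠ y in 𝓝[>] A, slope φ A y < κ := by
    have hder := hdiff.hasDerivAt
    rw [deriv_eq_zero_of_eq_zero_left hzero] at hder
    exact (hder.tendsto_slope.mono_left (nhdsWithin_mono _ fun y hy => ne_of_gt hy)).eventually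
      (gt_mem_nhds hκ)
  have hsmall : ∀ᶠ y in 𝓝[>] A, φ y < s₀ :=
    (hφ.continuousAt A hA).continuousWithinAt.eventually
      (gt_mem_nhds ((hzero A le_rfl).trans_lt hs₀))
  obtain ⟨y, ⟨hy_slope, hys⟩, hy⟩ := ((hslope_lt.and hsmall).and (Ioo_mem_nhdsGT hA)).exists
  have hgrow := hφ.mul_sub_le_sub hslope hy.1.le hy.2
    (fun ξ hξ => hpos ξ ⟨hξ.1, hξ.2.trans hy.2⟩) hys
  rw [slope_def_field, div_lt_iff₀ (sub_pos.2 hy.1)] at hy_slope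
  exact hy_slope.not_ge hgrow

end IsProfile

/-! ### The flux of a traveling wave -/

theorem hasDerivAt_of_hasDerivAt_comp {P θ : ℝ → ℝ} {p w ξ : ℝ}
    (hP : HasStrictDerivAt P p (θ ξ)) (hp : p ≠ 0) (hθ : ContinuousAt θ ξ)
    (h : HasDerivAt (fun x => P (θ x)) w ξ) : HasDerivAt θ (w / p) ξ := by
  have hinv : hP.localInverse P p (θ ξ) hp ∘ (fun x => P (θ x)) =ᶠ[𝓝 ξ] θ :=
    hθ.eventually (hP.hasStrictFDerivAt_equiv hp).eventually_left_inverse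
  have hder := (hP.to_localInverse hp).hasDerivAt.comp ξ h
  rw [inv_mul_eq_div] at hder
  exact hder.congr_of_eventuallyEq hinv.symm

/-- `w` is the continuous version of the diffusive flux `D(θ) θ'` of a traveling wave `θ` in `I`,
which the pointwise flux `diffFlux D θ` is only known to equal almost everywhere. -/
structure IsContFlux (f D g : ℝ → ℝ) (c : ℝ) (I : Set ℝ) (θ w : ℝ → ℝ) : Prop where
  hasDerivAt_primitive : ∀ ξ ∈ I, HasDerivAt (fun ξ => ∫ s in (0 : ℝ)..θ ξ, D s) (w ξ) ξ
  hasDerivAt : ∀ ξ ∈ I, HasDerivAt (fun ξ => w ξ - f (θ ξ) + c * θ ξ) (-g (θ ξ)) ξ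

section Flux

variable {r c ξ : ℝ} {f D g θ w : ℝ → ℝ} {I : Set ℝ}

theorem IsAdmissible.monotoneOn_primitive_D (h : IsAdmissible r f D g) :
    MonotoneOn (fun x => ∫ t in (0 : ℝ)..x, D t) (Icc 0 r) := by
  have hder (s : ℝ) (hs : s ∈ interior (Icc 0 r)) :
      HasDerivAt (fun x => ∫ t in (0 : ℝ)..x, D t) (D s) s := by
    rw [interior_Icc] at hs
    exact (h.hasStrictDerivAt_primitive_D hs).hasDerivAt
  refine monotoneOn_of_deriv_nonneg (convex_Icc 0 r) h.continuousOn_primitive_D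
    (fun s hs => (hder s hs).differentiableAt.differentiableWithinAt) fun s hs => ?_
  rw [(hder s hs).deriv]
  exact h.D_nonneg (interior_subset hs)

namespace IsTravelingWave

theorem continuousOn_comp (hθ : IsTravelingWave r f D g c I θ) {F : ℝ → ℝ}
    (hF : ContinuousOn F (Icc 0 r)) : ContinuousOn (fun ξ => F (θ ξ)) I :=
  hF.comp hθ.continuousOn hθ.mapsTo

theorem continuousAt (hθ : IsTravelingWave r f D g c I θ) (hξ : ξ ∈ I) : ContinuousAt θ ξ :=
  hθ.continuousOn.continuousAt (hθ.isOpen.mem_nhds hξ)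

theorem locallyIntegrableOn_flux (h : IsAdmissible r f D g)
    (hθ : IsTravelingWave r f D g c I θ) :
    LocallyIntegrableOn (fun ξ => diffFlux D θ ξ - f (θ ξ) + c * θ ξ) I :=
  (hθ.locallyIntegrableOn.sub ((hθ.continuousOn_comp
    h.data.f_contDiffOn.continuousOn).locallyIntegrableOn hθ.isOpen.measurableSet)).add
    ((continuousOn_const.mul hθ.continuousOn).locallyIntegrableOn hθ.isOpen.measurableSet)

theorem hasWeakDerivOn_flux (h : IsAdmissible r f D g) (hθ : IsTravelingWave r f D g c I θ) :
    HasWeakDerivOn (fun ξ => diffFlux D θ ξ - f (θ ξ) + c * θ ξ) (fun ξ => -g (θ ξ)) I := by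
  intro ψ hψ
  have heq := hθ.weakEquation ψ hψ.contDiff hψ.hasCompactSupport hψ.tsupport_subset
  have hg := (hθ.continuousOn_comp h.data.g_continuousOn).locallyIntegrableOn (μ := volume)
    hθ.isOpen.measurableSet
  rw [integral_sub (hψ.deriv.integrable_mul (hθ.locallyIntegrableOn_flux h)).integrableOn
    (hψ.integrable_mul hg).integrableOn] at heq
  simp only [neg_mul, integral_neg, neg_neg]
  exact sub_eq_zero.1 heq

theorem exists_isContFlux (h : IsAdmissible r f D g) (hθ : IsTravelingWave r f D g c I θ) :
    ∃ w, IsContFlux f D g c I θ w := by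
  rcases I.eq_empty_or_nonempty with rfl | ⟨x₀, hx₀⟩
  · exact ⟨0, fun ξ hξ => hξ.elim, fun ξ hξ => hξ.elim⟩
  have hg := (hθ.continuousOn_comp h.data.g_continuousOn).neg
  have hG (x : ℝ) (hx : x ∈ I) :
      HasDerivAt (fun x => ∫ t in x₀..x, -g (θ t)) (-g (θ x)) x :=
    hasDerivAt_integral_of_continuousOn hθ.isOpen hθ.ordConnected hg hx₀ hx
  obtain ⟨K, hK⟩ := (hθ.hasWeakDerivOn_flux h).exists_ae_eq_add_integral hθ.isOpen
    hθ.ordConnected (hθ.locallyIntegrableOn_flux h) hg hx₀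
  set w : ℝ → ℝ := fun x => K + (∫ t in x₀..x, -g (θ t)) + f (θ x) - c * θ x
  have hw : ContinuousOn w I :=
    ((continuousOn_const.add (HasDerivAt.continuousOn hG)).add
      (hθ.continuousOn_comp h.data.f_contDiffOn.continuousOn)).sub
      (continuousOn_const.mul hθ.continuousOn)
  have hw_ae : ∀ᵐ x ∂volume.restrict I, diffFlux D θ x = w x := by
    filter_upwards [hK] with x hx
    simp only [w]
    linarith
  have hweak : HasWeakDerivOn (fun ξ => ∫ s in (0 : ℝ)..θ ξ, D s) (diffFlux D θ) I :=
    fun ψ hψ => hθ.weakDeriv ψ hψ.contDiff hψ.hasCompactSupport hψ.tsupport_subset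
  refine ⟨w, fun ξ hξ => (hweak.congr_ae hw_ae).hasDerivAt hθ.isOpen hθ.ordConnected
    (hθ.continuousOn_comp h.continuousOn_primitive_D) hw hξ, fun ξ hξ => ?_⟩
  refine ((hG ξ hξ).const_add K).congr_of_eventuallyEq (Eventually.of_forall fun x => ?_)
  simp only [w]
  ring

end IsTravelingWave

namespace IsContFlux

theorem eq_zero_of_eq_right (h : IsAdmissible r f D g) (hθ : IsTravelingWave r f D g c I θ)
    (hw : IsContFlux f D g c I θ w) (hξ : ξ ∈ I) (heq : θ ξ = r) : w ξ = 0 := by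
  refine IsLocalMax.hasDerivAt_eq_zero ?_ (hw.hasDerivAt_primitive ξ hξ)
  filter_upwards [hθ.isOpen.mem_nhds hξ] with x hx
  rw [heq]
  exact h.monotoneOn_primitive_D (hθ.mapsTo hx) (right_mem_Icc.2 h.pos.le) (hθ.mapsTo hx).2

theorem eq_zero_of_eq_zero (h : IsAdmissible r f D g) (hθ : IsTravelingWave r f D g c I θ)
    (hw : IsContFlux f D g c I θ w) (hξ : ξ ∈ I) (heq : θ ξ = 0) : w ξ = 0 := by
  refine IsLocalMin.hasDerivAt_eq_zero ?_ (hw.hasDerivAt_primitive ξ hξ)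
  filter_upwards [hθ.isOpen.mem_nhds hξ] with x hx
  rw [heq]
  exact h.monotoneOn_primitive_D (left_mem_Icc.2 h.pos.le) (hθ.mapsTo hx) (hθ.mapsTo hx).1

theorem strictMonoOn (h : IsAdmissible r f D g) (hθ : IsTravelingWave r f D g c I θ)
    (hw : IsContFlux f D g c I θ w) {J : Set ℝ} (hJ : Convex ℝ J) (hJI : J ⊆ I)
    (hpos : ∀ ξ ∈ J, 0 < θ ξ) : StrictMonoOn (fun ξ => w ξ - f (θ ξ) + c * θ ξ) J := by
  refine strictMonoOn_of_deriv_pos hJ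
    (HasDerivAt.continuousOn fun ξ hξ => hw.hasDerivAt ξ (hJI hξ)) fun ξ hξ => ?_
  have hξJ := interior_subset hξ
  rw [(hw.hasDerivAt ξ (hJI hξJ)).deriv]
  exact neg_pos.2 (h.g_neg.1 _ ⟨hpos ξ hξJ, (hθ.mapsTo (hJI hξJ)).2⟩)

theorem continuousOn (h : IsAdmissible r f D g) (hθ : IsTravelingWave r f D g c I θ)
    (hw : IsContFlux f D g c I θ w) : ContinuousOn w I := by
  refine (((HasDerivAt.continuousOn hw.hasDerivAt).add
    (hθ.continuousOn_comp h.data.f_contDiffOn.continuousOn)).sub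
    (hθ.continuousOn.const_smul c)).congr fun ξ _ => ?_
  simp only [Pi.add_apply, Pi.sub_apply, Pi.smul_apply, smul_eq_mul]
  ring

theorem hasDerivAt_wave (h : IsAdmissible r f D g) (hθ : IsTravelingWave r f D g c I θ)
    (hw : IsContFlux f D g c I θ w) (hξ : ξ ∈ I) (hmem : θ ξ ∈ Ioo 0 r) :
    HasDerivAt θ (w ξ / D (θ ξ)) ξ :=
  hasDerivAt_of_hasDerivAt_comp (h.hasStrictDerivAt_primitive_D hmem) (h.D_pos _ hmem).ne'
    (hθ.continuousAt hξ) (hw.hasDerivAt_primitive ξ hξ)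

theorem hasDerivAt_flux (h : IsAdmissible r f D g) (hθ : IsTravelingWave r f D g c I θ)
    (hw : IsContFlux f D g c I θ w) (hξ : ξ ∈ I) (hmem : θ ξ ∈ Ioo 0 r) :
    HasDerivAt w (rate r f c (θ ξ) * (w ξ / D (θ ξ)) - g (θ ξ)) ξ := by
  have hθ' := hw.hasDerivAt_wave h hθ hξ hmem
  refine (((hw.hasDerivAt ξ hξ).add ((h.hasDerivAt_f hmem).comp ξ hθ')).sub
    (hθ'.const_mul c)).congr_of_eventuallyEq (Eventually.of_forall fun x => ?_)
    |>.congr_deriv ?_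
  · simp only [Pi.add_apply, Pi.sub_apply, Function.comp_apply]
    ring
  · rw [rate]
    ring

end IsContFlux

end Flux

/-! ### Strictness -/

namespace IsProfile

variable {r b c s : ℝ} {f D g z T φ Φ w : ℝ → ℝ}

theorem tendsto_nhdsLT (hr : 0 < r) (hφ : IsProfile r D z T b φ) :
    Tendsto φ (𝓝[<] b) (𝓝 r) := by
  refine tendsto_order.2 ⟨fun a ha => ?_, fun a ha => ?_⟩
  · obtain ⟨s, hs, hsr⟩ := exists_between (max_lt hr ha)
    have hs : s ∈ Ioo 0 r ∧ a < s := ⟨⟨(le_max_left _ _).trans_lt hs, hsr⟩,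
      (le_max_right _ _).trans_lt hs⟩
    have hlt := hφ.time_lt s hs.1
    filter_upwards [Ioo_mem_nhdsLT hlt] with ξ hξ
    exact hs.2.trans_le ((hφ.apply_time s hs.1).symm.trans_le (hφ.monotoneOn hlt hξ.2 hξ.1.le))
  · filter_upwards [self_mem_nhdsWithin] with ξ hξ using (hφ.mem_Ico ξ hξ).2.trans ha

theorem eq_right_of_eqOn (hr : 0 < r) (hφ : IsProfile r D z T b φ) (hΦ : ContinuousAt Φ b)
    (heq : EqOn Φ φ (Iio b)) : Φ b = r :=
  tendsto_nhds_unique hΦ.continuousWithinAt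
    ((hφ.tendsto_nhdsLT hr).congr' (eventuallyEq_nhdsWithin_of_eqOn heq.symm))

/-- The function `D(Φ) Φ' - f(Φ) + c Φ` is increasing where `Φ > 0`, and its first term vanishes at
`b`, where `Φ` attains its maximal value `r`. -/
theorem sub_mul_lt_of_eqOn (h : IsAdmissible r f D g) (hz : IsFluxSol r f D g c z)
    (hφ : IsProfile r D z T b φ) (hΦ : IsTravelingWave r f D g c univ Φ)
    (hw : IsContFlux f D g c univ Φ w) (heq : EqOn Φ φ (Iio b)) (hs : s ∈ Ioo 0 r) :
    f r - c * r < f s - c * s := by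
  have hTb : T s < b := hφ.time_lt s hs
  have hΦb : Φ b = r := hφ.eq_right_of_eqOn h.pos (hΦ.continuousAt (mem_univ b)) heq
  have hΦT : Φ (T s) = s := (heq hTb).trans (hφ.apply_time s hs)
  have hwT : 0 < w (T s) := by
    have hder := (hφ.hasDerivAt_primitive_D h hz hTb).congr_of_eventuallyEq
      ((heq.eventuallyEq_of_mem (Iio_mem_nhds hTb)).fun_comp fun x => ∫ t in (0 : ℝ)..x, D t)
    rw [(hw.hasDerivAt_primitive (T s) (mem_univ _)).unique hder,
      hφ.diffFlux_eq h.D_pos hz.zero hTb, hφ.apply_time s hs]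
    exact hz.pos s hs
  have hpos : ∀ ξ ∈ Icc (T s) b, 0 < Φ ξ := fun ξ hξ => by
    rcases hξ.2.eq_or_lt with rfl | hlt
    · exact h.pos.trans_eq hΦb.symm
    · rw [heq hlt]
      exact hs.1.trans_le ((hφ.apply_time s hs).symm.trans_le (hφ.monotoneOn hTb hlt hξ.1))
  have hlt := hw.strictMonoOn h hΦ (convex_Icc _ _) (subset_univ _) hpos
    (left_mem_Icc.2 hTb.le) (right_mem_Icc.2 hTb.le) hTb
  simp only [hΦT, hΦb, hw.eq_zero_of_eq_right h hΦ (mem_univ b) hΦb] at hlt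
  linarith

theorem isStrict (h : IsAdmissible r f D g) (hz : IsFluxSol r f D g c z)
    (hφ : IsProfile r D z T b φ) : IsStrict r f D g c (Iio b) φ := by
  refine ⟨fun huniv => lt_irrefl b (huniv.ge (mem_univ b)), ?_⟩
  rintro ⟨Φ, hΦ, heq⟩
  obtain ⟨w, hw⟩ := hΦ.exists_isContFlux h
  have hΦb : Φ b = r := hφ.eq_right_of_eqOn h.pos (hΦ.continuousAt (mem_univ b)) heq
  have hev : ∀ᶠ ξ in 𝓝[≥] b, 0 < Φ ξ :=
    (hΦ.continuousAt (mem_univ b)).continuousWithinAt.eventually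
      (lt_mem_nhds (h.pos.trans_eq hΦb.symm))
  obtain ⟨e, hbe : b < e, hpos⟩ := mem_nhdsGE_iff_exists_Icc_subset.1 hev
  have hw_pos (ξ : ℝ) (hξ : ξ ∈ Ioc b e) : 0 < w ξ := by
    have hlt := hw.strictMonoOn h hΦ (convex_Icc b e) (subset_univ _) hpos
      (left_mem_Icc.2 hbe.le) (Ioc_subset_Icc_self hξ) hξ.1
    simp only [hΦb, hw.eq_zero_of_eq_right h hΦ (mem_univ b) hΦb] at hlt
    rcases (hΦ.mapsTo (mem_univ ξ)).2.eq_or_lt with hr | hlt_r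
    · rw [hr] at hlt
      linarith
    · linarith [hφ.sub_mul_lt_of_eqOn h hz hΦ hw heq ⟨hpos (Ioc_subset_Icc_self hξ), hlt_r⟩]
  have hmono : StrictMonoOn (fun ξ => ∫ s in (0 : ℝ)..Φ ξ, D s) (Icc b e) := by
    refine strictMonoOn_of_deriv_pos (convex_Icc b e)
      (HasDerivAt.continuousOn fun ξ _ => hw.hasDerivAt_primitive ξ (mem_univ ξ)) fun ξ hξ => ?_
    rw [interior_Icc] at hξ
    rw [(hw.hasDerivAt_primitive ξ (mem_univ ξ)).deriv]
    exact hw_pos ξ ⟨hξ.1, hξ.2.le⟩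
  have hlt := hmono (left_mem_Icc.2 hbe.le) (right_mem_Icc.2 hbe.le) hbe
  simp only [hΦb] at hlt
  exact hlt.not_ge (h.monotoneOn_primitive_D (hΦ.mapsTo (mem_univ e))
    (right_mem_Icc.2 h.pos.le) (hΦ.mapsTo (mem_univ e)).2)

end IsProfile

/-! ### Uniqueness -/

theorem exists_deriv_lt_of_nonneg {u u' : ℝ → ℝ} {a ε : ℝ}
    (hu : ∀ x ≤ a, HasDerivAt u (u' x) x) (h_nonneg : ∀ x ≤ a, 0 ≤ u x) (hε : 0 < ε) :
    ∃ x ≤ a, u' x < ε := by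
  by_contra! h
  have ha : 0 < u a + 1 := by linarith [h_nonneg a le_rfl]
  have hx : a - (u a + 1) / ε ≤ a := sub_le_self _ (by positivity)
  have hint : interior (Iic a) ⊆ Iic a := interior_subset
  have hle := (convex_Iic a).mul_sub_le_image_sub_of_le_deriv (HasDerivAt.continuousOn hu)
    (fun x hx => (hu x (hint hx)).differentiableAt.differentiableWithinAt)
    (fun x hx => (h x (hint hx)).trans_eq (hu x (hint hx)).deriv.symm)
    _ hx a self_mem_Iic hx
  rw [sub_sub_cancel, mul_div_cancel₀ _ hε.ne'] at hle
  linarith [h_nonneg _ hx]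

namespace IsSemiWavefrontFrom

variable {r b b₀ c ξ ξ₁ ε : ℝ} {f D g z θ w T φ : ℝ → ℝ}

theorem nonneg (hθ : IsSemiWavefrontFrom r f D g c 0 b θ) (hξ : ξ < b) : 0 ≤ θ ξ :=
  (hθ.isTravelingWave.mapsTo hξ).1

theorem monotoneOn (hθ : IsSemiWavefrontFrom r f D g c 0 b θ) : MonotoneOn θ (Iio b) := by
  refine hθ.monotonic.resolve_right fun hanti => hθ.nonconstant ⟨0, fun ξ hξ => ?_⟩
  refine le_antisymm (ge_of_tendsto hθ.tendsto ?_) (hθ.nonneg hξ)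
  filter_upwards [Iic_mem_atBot ξ] with η hη using
    hanti (mem_Iio.2 (hη.trans_lt hξ)) hξ hη

theorem pos_of_le (hθ : IsSemiWavefrontFrom r f D g c 0 b θ) (hpos : 0 < θ ξ) (hle : ξ ≤ ξ₁)
    (hξ₁ : ξ₁ < b) : 0 < θ ξ₁ :=
  hpos.trans_le (hθ.monotoneOn (hle.trans_lt hξ₁) hξ₁ hle)

theorem exists_pos (hθ : IsSemiWavefrontFrom r f D g c 0 b θ) : ∃ ξ < b, 0 < θ ξ := by
  by_contra! h
  exact hθ.nonconstant ⟨0, fun ξ hξ => le_antisymm (h ξ hξ) (hθ.nonneg hξ)⟩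

theorem lt_right (h : IsAdmissible r f D g) (hθ : IsSemiWavefrontFrom r f D g c 0 b θ)
    (hw : IsContFlux f D g c (Iio b) θ w) (hξ : ξ < b) : θ ξ < r := by
  have htw := hθ.isTravelingWave
  refine (htw.mapsTo hξ).2.lt_of_ne fun heq => ?_
  have hθ_eq : ∀ η ∈ Ioo ξ b, θ η = r := fun η hη =>
    le_antisymm (htw.mapsTo hη.2).2 (heq.symm.trans_le (hθ.monotoneOn hξ hη.2 hη.1.le))
  obtain ⟨η, hη⟩ := exists_between hξ
  have hconst : (fun ξ => w ξ - f (θ ξ) + c * θ ξ) =ᶠ[𝓝 η] fun _ => 0 - f r + c * r := by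
    filter_upwards [Ioo_mem_nhds hη.1 hη.2] with x hx
    rw [hw.eq_zero_of_eq_right h htw hx.2 (hθ_eq x hx), hθ_eq x hx]
  have hzero := (hw.hasDerivAt η hη.2).unique ((hasDerivAt_const η _).congr_of_eventuallyEq hconst)
  rw [hθ_eq η hη, neg_eq_zero] at hzero
  exact (h.g_neg.1 r ⟨h.pos, le_rfl⟩).ne hzero

theorem flux_nonneg (h : IsAdmissible r f D g) (hθ : IsSemiWavefrontFrom r f D g c 0 b θ)
    (hw : IsContFlux f D g c (Iio b) θ w) (hξ : ξ < b) : 0 ≤ w ξ := by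
  rw [← (hw.hasDerivAt_primitive ξ hξ).deriv, ← derivWithin_of_mem_nhds (Iio_mem_nhds hξ)]
  exact (h.monotoneOn_primitive_D.comp hθ.monotoneOn hθ.isTravelingWave.mapsTo).derivWithin_nonneg

theorem exists_flux_lt (h : IsAdmissible r f D g) (hθ : IsSemiWavefrontFrom r f D g c 0 b θ)
    (hw : IsContFlux f D g c (Iio b) θ w) (hz : IsFluxSol r f D g c z) (hξ₁ : ξ₁ < b)
    (hpos₁ : 0 < θ ξ₁) (hε : 0 < ε) : ∃ ξ ≤ ξ₁, 0 < θ ξ ∧ w ξ < ε ∧ z (θ ξ) < ε := by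
  have htw := hθ.isTravelingWave
  have hmem : MapsTo θ (Iio b) (Ico 0 r) := fun ξ hξ => ⟨hθ.nonneg hξ, hθ.lt_right h hw hξ⟩
  rcases pos_or_exists_zero_set (fun ξ hξ => hθ.nonneg hξ) (fun ξ hξ => htw.continuousAt hξ)
    hθ.monotoneOn hθ.exists_pos with hall | ⟨A, hA, hzero, hpos⟩
  · have hz_lim : Tendsto (fun ξ => z (θ ξ)) atBot (𝓝 (z 0)) :=
      (hz.continuousOn 0 ⟨le_rfl, h.pos⟩).tendsto.comp <| tendsto_nhdsWithin_iff.2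
        ⟨hθ.tendsto, by filter_upwards [Iio_mem_atBot b] with ξ hξ using hmem hξ⟩
    obtain ⟨a, ha⟩ := eventually_atBot.1
      ((hz_lim.eventually (gt_mem_nhds (hz.zero.trans_lt hε))).and (Iic_mem_atBot ξ₁))
    obtain ⟨x, hxa, hwx⟩ := exists_deriv_lt_of_nonneg
      (fun x hx => hw.hasDerivAt_primitive x ((ha x hx).2.trans_lt hξ₁))
      (fun x hx => intervalIntegral.integral_nonneg (hθ.nonneg ((ha x hx).2.trans_lt hξ₁))
        fun t ht => h.D_nonneg ⟨ht.1, ht.2.trans (htw.mapsTo ((ha x hx).2.trans_lt hξ₁)).2⟩) hε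
    exact ⟨x, (ha x hxa).2, hall x ((ha x hxa).2.trans_lt hξ₁), hwx, (ha x hxa).1⟩
  · have hAξ : A < ξ₁ := lt_of_not_ge fun hle => hpos₁.ne' (hzero ξ₁ hle)
    have hw_lt : ∀ᶠ ξ in 𝓝 A, w ξ < ε :=
      ((hw.continuousOn h htw).continuousAt (Iio_mem_nhds hA)).eventually
        (gt_mem_nhds ((hw.eq_zero_of_eq_zero h htw hA (hzero A le_rfl)).trans_lt hε))
    have hz_lt : ∀ᶠ ξ in 𝓝 A, z (θ ξ) < ε := by
      refine ((hz.continuousOn.comp htw.continuousOn hmem).continuousAt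
        (Iio_mem_nhds hA)).eventually (gt_mem_nhds ?_)
      rwa [Function.comp_apply, hzero A le_rfl, hz.zero]
    obtain ⟨ξ, ⟨hwξ, hzξ⟩, hξ⟩ :=
      (((hw_lt.and hz_lt).filter_mono nhdsWithin_le_nhds).and (Ioo_mem_nhdsGT hAξ)).exists
    exact ⟨ξ, hξ.2.le, hpos ξ ⟨hξ.1, hξ.2.trans hξ₁⟩, hwξ, hzξ⟩

theorem hasDerivAt_sub_sq (h : IsAdmissible r f D g) (hθ : IsSemiWavefrontFrom r f D g c 0 b θ)
    (hw : IsContFlux f D g c (Iio b) θ w) (hz : IsFluxSol r f D g c z) (hξ : ξ < b)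
    (hpos : 0 < θ ξ) :
    HasDerivAt (fun ξ => (w ξ - z (θ ξ)) ^ 2)
      (2 * (w ξ - z (θ ξ)) ^ 2 * (g (θ ξ) / z (θ ξ))) ξ := by
  have hmem : θ ξ ∈ Ioo 0 r := ⟨hpos, hθ.lt_right h hw hξ⟩
  have hder := (hw.hasDerivAt_flux h hθ.isTravelingWave hξ hmem).sub
    ((hz.hasDerivAt _ hmem).comp ξ (hw.hasDerivAt_wave h hθ.isTravelingWave hξ hmem))
  refine (hder.pow 2).congr_deriv ?_
  have hz_ne := (hz.pos _ hmem).ne'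
  have hD_ne := (h.D_pos _ hmem).ne'
  simp only [Pi.sub_apply, Function.comp_apply, reaction]
  field_simp
  ring

theorem flux_eq (h : IsAdmissible r f D g) (hθ : IsSemiWavefrontFrom r f D g c 0 b θ)
    (hw : IsContFlux f D g c (Iio b) θ w) (hz : IsFluxSol r f D g c z) (hξ₁ : ξ₁ < b)
    (hpos₁ : 0 < θ ξ₁) : w ξ₁ = z (θ ξ₁) := by
  refine eq_of_abs_sub_le_all fun ε hε => ?_
  obtain ⟨ξ, hξ, hpos, hw_lt, hz_lt⟩ := hθ.exists_flux_lt h hw hz hξ₁ hpos₁ hε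
  have hmem : ∀ η ∈ Icc ξ ξ₁, θ η ∈ Ioo 0 r := fun η hη =>
    ⟨hθ.pos_of_le hpos hη.1 (hη.2.trans_lt hξ₁), hθ.lt_right h hw (hη.2.trans_lt hξ₁)⟩
  have hder : ∀ η ∈ Icc ξ ξ₁, HasDerivAt (fun ξ => (w ξ - z (θ ξ)) ^ 2)
      (2 * (w η - z (θ η)) ^ 2 * (g (θ η) / z (θ η))) η := fun η hη =>
    hθ.hasDerivAt_sub_sq h hw hz (hη.2.trans_lt hξ₁) (hmem η hη).1
  have hanti : AntitoneOn (fun ξ => (w ξ - z (θ ξ)) ^ 2) (Icc ξ ξ₁) := by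
    refine antitoneOn_of_deriv_nonpos (convex_Icc ξ ξ₁) (HasDerivAt.continuousOn hder)
      (fun η hη => (hder η (interior_subset hη)).differentiableAt.differentiableWithinAt)
      fun η hη => ?_
    have hη' := hmem η (interior_subset hη)
    rw [(hder η (interior_subset hη)).deriv]
    exact mul_nonpos_of_nonneg_of_nonpos (by positivity) (div_nonpos_of_nonpos_of_nonneg
      (h.g_nonpos (Ioo_subset_Icc_self hη')) (hz.pos _ hη').le)
  have hle : |w ξ₁ - z (θ ξ₁)| ≤ |w ξ - z (θ ξ)| :=
    sq_le_sq.1 (hanti (left_mem_Icc.2 hξ) (right_mem_Icc.2 hξ) hξ)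
  refine hle.trans (abs_le.2 ⟨?_, ?_⟩)
  · linarith [hθ.flux_nonneg h hw (hξ.trans_lt hξ₁)]
  · linarith [hz.pos _ (hmem ξ (left_mem_Icc.2 hξ))]

theorem exists_time_eq (h : IsAdmissible r f D g) (hθ : IsSemiWavefrontFrom r f D g c 0 b θ)
    (hw : IsContFlux f D g c (Iio b) θ w) (hz : IsFluxSol r f D g c z)
    (hT : ∀ s ∈ Ioo 0 r, HasDerivAt T (D s / z s) s) :
    ∃ τ, ∀ ξ < b, 0 < θ ξ → T (θ ξ) = ξ + τ := by
  have htw := hθ.isTravelingWave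
  have hopen : IsOpen (Iio b ∩ θ ⁻¹' Ioi 0) :=
    htw.continuousOn.isOpen_inter_preimage isOpen_Iio isOpen_Ioi
  have hconn : IsPreconnected (Iio b ∩ θ ⁻¹' Ioi 0) :=
    OrdConnected.isPreconnected ⟨fun x hx y hy t ht =>
      ⟨ht.2.trans_lt hy.1, hθ.pos_of_le hx.2 ht.1 (ht.2.trans_lt hy.1)⟩⟩
  have hder : ∀ ξ ∈ Iio b ∩ θ ⁻¹' Ioi 0, HasDerivAt (fun ξ => T (θ ξ)) 1 ξ := by
    rintro ξ ⟨hξ, hpos⟩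
    have hmem : θ ξ ∈ Ioo 0 r := ⟨hpos, hθ.lt_right h hw hξ⟩
    refine ((hT _ hmem).comp ξ (hw.hasDerivAt_wave h htw hξ hmem)).congr_deriv ?_
    rw [hθ.flux_eq h hw hz hξ hpos,
      div_mul_div_cancel₀ (hz.pos _ hmem).ne', div_self (h.D_pos _ hmem).ne']
  obtain ⟨τ, hτ⟩ := hopen.exists_eq_add_of_deriv_eq hconn (g := id)
    (fun ξ hξ => (hder ξ hξ).differentiableAt.differentiableWithinAt) differentiableOn_id
    fun ξ hξ => (hder ξ hξ).deriv.trans (deriv_id ξ).symm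
  exact ⟨τ, fun ξ hξ hpos => hτ ⟨hξ, hpos⟩⟩

theorem exists_shift (h : IsAdmissible r f D g) (hz : IsFluxSol r f D g c z)
    (hφ : IsProfile r D z T b₀ φ) (hθ : IsSemiWavefrontFrom r f D g c 0 b θ) :
    ∃ τ, b + τ ≤ b₀ ∧ ∀ ξ < b, θ ξ = φ (ξ + τ) := by
  obtain ⟨w, hw⟩ := hθ.isTravelingWave.exists_isContFlux h
  obtain ⟨τ, hτ⟩ := hθ.exists_time_eq h hw hz hφ.hasDerivAt_time
  obtain ⟨ξ₁, hξ₁, hpos₁⟩ := hθ.exists_pos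
  have heq (ξ : ℝ) (hξ : ξ < b) (hpos : 0 < θ ξ) : θ ξ = φ (ξ + τ) := by
    rw [← hτ ξ hξ hpos, hφ.apply_time _ ⟨hpos, hθ.lt_right h hw hξ⟩]
  have hb : b + τ ≤ b₀ := by
    by_contra! hlt
    obtain ⟨ξ, hξ, hξb⟩ := exists_between (max_lt hξ₁ (sub_lt_iff_lt_add.2 hlt))
    have hpos := hθ.pos_of_le hpos₁ ((le_max_left _ _).trans hξ.le) hξb
    have htime := hφ.time_lt (θ ξ) ⟨hpos, hθ.lt_right h hw hξb⟩
    rw [hτ ξ hξb hpos] at htime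
    linarith [(le_max_right ξ₁ (b₀ - τ)).trans_lt hξ]
  refine ⟨τ, hb, fun ξ hξ => ?_⟩
  have hξτ : ξ + τ < b₀ := (add_lt_add_left hξ τ).trans_le hb
  rcases (hθ.nonneg hξ).eq_or_lt' with hzero | hpos
  · rw [hzero]
    refine le_antisymm (hφ.mem_Ico _ hξτ).1 (le_of_not_gt fun hφ_pos => ?_)
    have hξξ₁ : ξ ≤ ξ₁ := (hθ.monotoneOn.reflect_lt hξ hξ₁ (hzero.trans_lt hpos₁)).le
    obtain ⟨s, hs, hs_lt⟩ := exists_between (lt_min hφ_pos hpos₁)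
    obtain ⟨η, hη, rfl⟩ := intermediate_value_Icc hξξ₁
      (hθ.isTravelingWave.continuousOn.mono fun η hη => hη.2.trans_lt hξ₁)
      ⟨hzero.trans_le hs.le, hs_lt.le.trans (min_le_right _ _)⟩
    have hηb : η < b := hη.2.trans_lt hξ₁
    have hle : φ (ξ + τ) ≤ θ η := by
      rw [heq η hηb hs]
      exact hφ.monotoneOn hξτ ((add_lt_add_left hηb τ).trans_le hb) (add_le_add_left hη.1 τ)
    exact hle.not_gt (hs_lt.trans_le (min_le_left _ _))
  · exact heq ξ hξ hpos

end IsSemiWavefrontFrom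

/-! ### The type of the profile -/

theorem exists_forall_neg_of_continuousOn {r : ℝ} {F : ℝ → ℝ} (hr : 0 < r)
    (hF : ContinuousOn F (Icc 0 r)) (h_neg : F 0 < 0) :
    ∃ s₀ ∈ Ioo 0 r, ∀ s ∈ Ioo 0 s₀, F s < 0 := by
  have hev : ∀ᶠ s in 𝓝[>] (0 : ℝ), F s < 0 := by
    rw [← nhdsWithin_Ioo_eq_nhdsGT hr]
    exact ((hF 0 ⟨le_rfl, hr.le⟩).mono Ioo_subset_Icc_self).eventually (gt_mem_nhds h_neg)
  obtain ⟨u, hu, hsub⟩ := mem_nhdsGT_iff_exists_Ioo_subset.1 hev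
  obtain ⟨s₀, hs₀, hs₀_lt⟩ := exists_between (lt_min (mem_Ioi.1 hu) hr)
  exact ⟨s₀, ⟨hs₀, hs₀_lt.trans_le (min_le_right _ _)⟩,
    fun s hs => hsub ⟨hs.1, hs.2.trans (hs₀_lt.trans_le (min_le_left _ _))⟩⟩

namespace IsAdmissible

variable {r s : ℝ} {f D g : ℝ → ℝ}

theorem hasDerivAt_D (h : IsAdmissible r f D g) (hs : s ∈ Ioo 0 r) :
    HasDerivAt D (dot r D s) s :=
  ((h.data.D_contDiffOn.differentiableOn one_ne_zero) s
    (Ioo_subset_Icc_self hs)).hasDerivWithinAt.hasDerivAt (Icc_mem_nhds hs.1 hs.2)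

theorem continuousOn_dot_D (h : IsAdmissible r f D g) : ContinuousOn (dot r D) (Icc 0 r) :=
  h.data.D_contDiffOn.continuousOn_derivWithin (uniqueDiffOn_Icc h.pos) le_rfl

theorem dot_D_nonneg (h : IsAdmissible r f D g) (hD0 : D 0 = 0) : 0 ≤ dot r D 0 := by
  have hder : HasDerivWithinAt D (dot r D 0) (Ioo 0 r) 0 :=
    ((h.data.D_contDiffOn.differentiableOn one_ne_zero) 0
      ⟨le_rfl, h.pos.le⟩).hasDerivWithinAt.mono Ioo_subset_Icc_self
  rw [hasDerivWithinAt_iff_tendsto_slope' left_notMem_Ioo, nhdsWithin_Ioo_eq_nhdsGT h.pos] at hder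
  refine ge_of_tendsto hder ?_
  filter_upwards [Ioo_mem_nhdsGT h.pos] with s hs
  rw [slope_def_field, hD0, sub_zero, sub_zero]
  exact div_nonneg (h.D_pos s hs).le hs.1.le

end IsAdmissible

namespace IsFluxSol

variable {r c η κ : ℝ} {f D g z : ℝ → ℝ}

theorem tendsto_div_of_pos (h : IsAdmissible r f D g) (hz : IsFluxSol r f D g c z)
    (hD0 : 0 < D 0) : Tendsto (fun s => z s / D s) (𝓝[>] 0) (𝓝 0) := by
  have hzero : (0 : ℝ) ∈ Ico 0 r := ⟨le_rfl, h.pos⟩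
  have hcont : ContinuousWithinAt (z / D) (Ioo 0 r) 0 :=
    ((hz.continuousOn 0 hzero).div ((h.continuousOn_D.mono Ico_subset_Icc_self) 0 hzero)
      hD0.ne').mono Ioo_subset_Ico_self
  rwa [ContinuousWithinAt, nhdsWithin_Ioo_eq_nhdsGT h.pos, Pi.div_apply, hz.zero, zero_div]
    at hcont

theorem eventually_le_mul (h : IsAdmissible r f D g) (hz : IsFluxSol r f D g c z)
    (hD0 : D 0 = 0) (hη : 0 < η) (hlt : rate r f c 0 < η * dot r D 0) :
    ∀ᶠ s in 𝓝[>] 0, z s ≤ η * D s := by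
  obtain ⟨s₀, hs₀, h_neg⟩ := exists_forall_neg_of_continuousOn h.pos
    (F := fun s => rate r f c s - g s / η - η * dot r D s)
    ((h.continuousOn_rate.sub (h.data.g_continuousOn.div_const η)).sub
      (continuousOn_const.mul h.continuousOn_dot_D))
    (by rwa [h.g_neg.2, zero_div, sub_zero, sub_neg])
  have hsub : Icc 0 s₀ ⊆ Ico 0 r := fun t ht => ⟨ht.1, ht.2.trans_lt hs₀.2⟩
  have hmem (t : ℝ) (ht : t ∈ Ioo 0 s₀) : t ∈ Ioo 0 r := ⟨ht.1, ht.2.trans hs₀.2⟩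
  filter_upwards [Ioo_mem_nhdsGT hs₀.1] with s hs
  refine le_of_deriv_le_of_lt (v := fun s => η * D s) (hz.continuousOn.mono hsub)
    (continuousOn_const.mul (h.continuousOn_D.mono (hsub.trans Ico_subset_Icc_self)))
    (fun t ht => hz.hasDerivAt t (hmem t ht))
    (fun t ht => (h.hasDerivAt_D (hmem t ht)).const_mul η)
    (by rw [hz.zero, hD0, mul_zero]) (fun t ht hlt_z => ?_) (Ioo_subset_Icc_self hs)
  have hg : reaction D g t / z t ≤ -(g t / η) := by
    rw [← neg_div, div_le_div_iff₀ (hz.pos t (hmem t ht)) hη, reaction]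
    linarith [mul_le_mul_of_nonneg_left hlt_z.le
      (neg_nonneg.2 (h.g_nonpos (Ioo_subset_Icc_self (hmem t ht))))]
  linarith [h_neg t ht]

theorem eventually_mul_le (h : IsAdmissible r f D g) (hz : IsFluxSol r f D g c z)
    (hD0 : D 0 = 0) (hlt : κ * dot r D 0 < rate r f c 0) :
    ∀ᶠ s in 𝓝[>] 0, κ * D s ≤ z s := by
  obtain ⟨s₀, hs₀, h_neg⟩ := exists_forall_neg_of_continuousOn h.pos
    (F := fun s => κ * dot r D s - rate r f c s)
    ((continuousOn_const.mul h.continuousOn_dot_D).sub h.continuousOn_rate) (sub_neg.2 hlt)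
  have hsub : Icc 0 s₀ ⊆ Ico 0 r := fun t ht => ⟨ht.1, ht.2.trans_lt hs₀.2⟩
  have hmem (t : ℝ) (ht : t ∈ Ioo 0 s₀) : t ∈ Ioo 0 r := ⟨ht.1, ht.2.trans hs₀.2⟩
  filter_upwards [Ioo_mem_nhdsGT hs₀.1] with s hs
  refine le_of_deriv_le_of_lt (u := fun s => κ * D s)
    (continuousOn_const.mul (h.continuousOn_D.mono (hsub.trans Ico_subset_Icc_self)))
    (hz.continuousOn.mono hsub) (fun t ht => (h.hasDerivAt_D (hmem t ht)).const_mul κ)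
    (fun t ht => hz.hasDerivAt t (hmem t ht))
    (by rw [hz.zero, hD0, mul_zero]) (fun t ht _ => ?_) (Ioo_subset_Icc_self hs)
  linarith [h_neg t ht, div_pos (h.reaction_pos (hmem t ht)) (hz.pos t (hmem t ht))]

theorem tendsto_div_of_lt (h : IsAdmissible r f D g) (hz : IsFluxSol r f D g c z)
    (hD0 : D 0 = 0) (hlt : ∀ η > 0, rate r f c 0 < η * dot r D 0) :
    Tendsto (fun s => z s / D s) (𝓝[>] 0) (𝓝 0) := by
  refine tendsto_order.2 ⟨fun a ha => ?_, fun a ha => ?_⟩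
  · filter_upwards [Ioo_mem_nhdsGT h.pos] with s hs
    exact ha.trans (div_pos (hz.pos s hs) (h.D_pos s hs))
  · obtain ⟨η, hη, hηa⟩ := exists_between ha
    filter_upwards [hz.eventually_le_mul h hD0 hη (hlt η hη), Ioo_mem_nhdsGT h.pos] with s hle hs
    exact ((div_le_iff₀ (h.D_pos s hs)).2 hle).trans_lt hηa

theorem exists_mul_le_of_pos (h : IsAdmissible r f D g) (hz : IsFluxSol r f D g c z)
    (hD0 : D 0 = 0) (hpos : 0 < rate r f c 0) : ∃ κ > 0, ∀ᶠ s in 𝓝[>] 0, κ * D s ≤ z s := by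
  obtain ⟨κ, hκ, hlt⟩ := exists_pos_mul_lt hpos (dot r D 0)
  exact ⟨κ, hκ, hz.eventually_mul_le h hD0 (by rwa [mul_comm])⟩

end IsFluxSol

/-! ### Examples with quadratic diffusivity -/

/-- The source term for which, with `D s = s ^ 2` and `h = c`, the first-order problem is solved by
`s ^ (m + 2)`: then `z / D = s ^ m`, so that the profile is sharp for `m = 0` and classical
otherwise. -/
def powSource (m : ℕ) (s : ℝ) : ℝ := -((m + 2) * s ^ (2 * m + 1))

section Examples

variable {r : ℝ}

theorem isAdmissible_powSource (hr : 0 < r) (c : ℝ) (m : ℕ) :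
    IsAdmissible r (fun s => c * s) (fun s => s ^ 2) (powSource m) where
  pos := hr
  data :=
    { f_contDiffOn := by fun_prop
      f_zero := mul_zero c
      D_contDiffOn := by fun_prop
      g_continuousOn := by
        unfold powSource
        fun_prop }
  D_pos _ hs := pow_pos hs.1 2
  g_neg := ⟨fun s hs => neg_neg_of_pos (mul_pos (by positivity) (pow_pos hs.1 _)), by
    rw [powSource, zero_pow (Nat.succ_ne_zero _), mul_zero, neg_zero]⟩

theorem dot_const_mul (hr : 0 < r) (c : ℝ) {s : ℝ} (hs : s ∈ Icc 0 r) :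
    dot r (fun s => c * s) s = c :=
  (hasDerivAt_const_mul c).hasDerivWithinAt.derivWithin (uniqueDiffOn_Icc hr s hs)

theorem dot_sq_zero (hr : 0 < r) : dot r (fun s => s ^ 2) 0 = 0 := by
  have hder : HasDerivAt (fun s : ℝ => s ^ 2) 0 0 := by
    simpa only [mul_zero, zero_mul, Nat.add_one_sub_one, pow_one] using hasDerivAt_pow 2 (0 : ℝ)
  exact hder.hasDerivWithinAt.derivWithin (uniqueDiffOn_Icc hr 0 ⟨le_rfl, hr.le⟩)

theorem isFluxSol_powSource (hr : 0 < r) (c : ℝ) (m : ℕ) :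
    IsFluxSol r (fun s => c * s) (fun s => s ^ 2) (powSource m) c fun s => s ^ (m + 2) where
  zero := zero_pow (Nat.succ_ne_zero _)
  continuousOn := by fun_prop
  pos _ hs := pow_pos hs.1 _
  hasDerivAt s hs := by
    refine (hasDerivAt_pow (m + 2) s).congr_deriv ?_
    have hs_ne := hs.1.ne'
    rw [rate, dot_const_mul hr c (Ioo_subset_Icc_self hs), sub_self, zero_add, reaction, powSource,
      eq_div_iff (pow_ne_zero _ hs_ne)]
    push_cast
    ring
  bddAbove := ⟨r ^ (m + 2), fun _ hs => pow_le_pow_left₀ hs.1.le hs.2.le _⟩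

theorem exists_isClassicalOn_of_dot_D_eq_zero (hr : 0 < r) (c : ℝ) :
    ∃ f D g : ℝ → ℝ, IsData r f D g ∧ DHat r D ∧ GHat r g ∧
      D 0 = 0 ∧ dot r D 0 = 0 ∧ c = dot r f 0 ∧
      ∃ (b : ℝ) (φ : ℝ → ℝ), IsSemiWavefrontFrom r f D g c 0 b φ ∧
        IsClassicalOn r f D g c (Iio b) φ := by
  have h := isAdmissible_powSource hr c 1
  have hz := isFluxSol_powSource hr c 1
  obtain ⟨T, b, φ, hφ⟩ := h.exists_isProfile hz
  refine ⟨_, _, _, h.data, h.D_pos, h.g_neg, zero_pow two_ne_zero, dot_sq_zero hr,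
    (dot_const_mul hr c ⟨le_rfl, hr.le⟩).symm, b, φ, hφ.isSemiWavefrontFrom h hz,
    hφ.isClassicalOn_of_tendsto h hz ?_⟩
  refine (tendsto_id.mono_left nhdsWithin_le_nhds).congr' ?_
  filter_upwards [self_mem_nhdsWithin] with s hs
  rw [id, pow_succ, mul_div_cancel_left₀ _ (pow_ne_zero 2 (mem_Ioi.1 hs).ne')]

theorem exists_isSharpAt_of_dot_D_eq_zero (hr : 0 < r) (c : ℝ) :
    ∃ f D g : ℝ → ℝ, IsData r f D g ∧ DHat r D ∧ GHat r g ∧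
      D 0 = 0 ∧ dot r D 0 = 0 ∧ c = dot r f 0 ∧
      ∃ (b : ℝ) (φ : ℝ → ℝ), IsSemiWavefrontFrom r f D g c 0 b φ ∧
        IsSharpAt r f D g c (Iio b) φ 0 := by
  have h := isAdmissible_powSource hr c 0
  have hz := isFluxSol_powSource hr c 0
  obtain ⟨T, b, φ, hφ⟩ := h.exists_isProfile hz
  exact ⟨_, _, _, h.data, h.D_pos, h.g_neg, zero_pow two_ne_zero, dot_sq_zero hr,
    (dot_const_mul hr c ⟨le_rfl, hr.le⟩).symm, b, φ, hφ.isSemiWavefrontFrom h hz,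
    hφ.isSharpAt_of_le h hz one_pos (Eventually.of_forall fun s => (one_mul (s ^ 2)).le)⟩

end Examples

end SemiWave

theorem mainTheorem2_general (r : ℝ) (hr : 0 < r) :
    (∀ f D g : ℝ → ℝ, SemiWave.IsData r f D g → SemiWave.DHat r D → SemiWave.GHat r g →
      ∀ c : ℝ, ∃ (b : ℝ) (φ : ℝ → ℝ),
        SemiWave.IsSemiWavefrontFrom r f D g c 0 b φ ∧
        SemiWave.IsClassicalOrSharp r f D g c (Set.Iio b) φ ∧
        SemiWave.IsStrict r f D g c (Set.Iio b) φ ∧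
        (∀ (b' : ℝ) (φ' : ℝ → ℝ), SemiWave.IsSemiWavefrontFrom r f D g c 0 b' φ' →
          ∃ τ : ℝ, b' + τ ≤ b ∧ ∀ ξ < b', φ' ξ = φ (ξ + τ)) ∧
        (0 < D 0 → SemiWave.IsClassicalOn r f D g c (Set.Iio b) φ) ∧
        (D 0 = 0 →
          (c < SemiWave.dot r f 0 → SemiWave.IsSharpAt r f D g c (Set.Iio b) φ 0) ∧
          (SemiWave.dot r f 0 < c → SemiWave.IsClassicalOn r f D g c (Set.Iio b) φ) ∧
          (c = SemiWave.dot r f 0 → 0 < SemiWave.dot r D 0 →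
            SemiWave.IsClassicalOn r f D g c (Set.Iio b) φ))) ∧
    (∀ c : ℝ,
      (∃ f D g : ℝ → ℝ, SemiWave.IsData r f D g ∧ SemiWave.DHat r D ∧ SemiWave.GHat r g ∧
        D 0 = 0 ∧ SemiWave.dot r D 0 = 0 ∧ c = SemiWave.dot r f 0 ∧
        ∃ (b : ℝ) (φ : ℝ → ℝ), SemiWave.IsSemiWavefrontFrom r f D g c 0 b φ ∧
          SemiWave.IsClassicalOn r f D g c (Set.Iio b) φ) ∧
      (∃ f D g : ℝ → ℝ, SemiWave.IsData r f D g ∧ SemiWave.DHat r D ∧ SemiWave.GHat r g ∧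
        D 0 = 0 ∧ SemiWave.dot r D 0 = 0 ∧ c = SemiWave.dot r f 0 ∧
        ∃ (b : ℝ) (φ : ℝ → ℝ), SemiWave.IsSemiWavefrontFrom r f D g c 0 b φ ∧
          SemiWave.IsSharpAt r f D g c (Set.Iio b) φ 0)) := by
  refine ⟨fun f D g hd hD hg c => ?_, fun c =>
    ⟨SemiWave.exists_isClassicalOn_of_dot_D_eq_zero hr c,
      SemiWave.exists_isSharpAt_of_dot_D_eq_zero hr c⟩⟩
  have h : SemiWave.IsAdmissible r f D g := ⟨hr, hd, hD, hg⟩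
  obtain ⟨z, hz⟩ := h.exists_isFluxSol c
  obtain ⟨T, b, φ, hφ⟩ := h.exists_isProfile hz
  refine ⟨b, φ, hφ.isSemiWavefrontFrom h hz, hφ.isClassicalOrSharp h hz, hφ.isStrict h hz,
    fun b' φ' hφ' => hφ'.exists_shift h hz hφ, fun hD0 => ?_,
    fun hD0 => ⟨fun hlt => ?_, fun hlt => ?_, fun heq hdot => ?_⟩⟩
  · exact hφ.isClassicalOn_of_tendsto h hz (hz.tendsto_div_of_pos h hD0)
  · obtain ⟨κ, hκ, hle⟩ := hz.exists_mul_le_of_pos h hD0 (sub_pos.2 hlt)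
    exact hφ.isSharpAt_of_le h hz hκ hle
  · exact hφ.isClassicalOn_of_tendsto h hz (hz.tendsto_div_of_lt h hD0 fun η hη =>
      (sub_neg.2 hlt).trans_le (mul_nonneg hη.le (h.dot_D_nonneg hD0)))
  · exact hφ.isClassicalOn_of_tendsto h hz (hz.tendsto_div_of_lt h hD0 fun η hη =>
      (sub_eq_zero.2 heq.symm).trans_lt (mul_pos hη hdot))

theorem mainTheorem2 (r : ℝ) (hr : 0 < r) :
    -- existence, uniqueness up to shifts, strictness and type of the profile
    (∀ f D g : ℝ → ℝ, SemiWave.IsData r f D g → SemiWave.DHat r D → SemiWave.GHat r g →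
      ∀ c : ℝ, ∃ (b : ℝ) (φ : ℝ → ℝ),
        SemiWave.IsSemiWavefrontFrom r f D g c 0 b φ ∧
        SemiWave.IsClassicalOrSharp r f D g c (Set.Iio b) φ ∧
        SemiWave.IsStrict r f D g c (Set.Iio b) φ ∧
        (∀ (b' : ℝ) (φ' : ℝ → ℝ), SemiWave.IsSemiWavefrontFrom r f D g c 0 b' φ' →
          SemiWave.IsClassicalOrSharp r f D g c (Set.Iio b') φ' →
          ∃ τ : ℝ, b' + τ ≤ b ∧ ∀ ξ < b', φ' ξ = φ (ξ + τ)) ∧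
        (0 < D 0 → SemiWave.IsClassicalOn r f D g c (Set.Iio b) φ) ∧
        (D 0 = 0 →
          (c < SemiWave.dot r f 0 → SemiWave.IsSharpAt r f D g c (Set.Iio b) φ 0) ∧
          (SemiWave.dot r f 0 < c → SemiWave.IsClassicalOn r f D g c (Set.Iio b) φ) ∧
          (c = SemiWave.dot r f 0 → 0 < SemiWave.dot r D 0 →
            SemiWave.IsClassicalOn r f D g c (Set.Iio b) φ))) ∧
    -- if `D(0) = 0`, `c = h(0)` and `D'(0) = 0`, both types occur
    (∀ c : ℝ,
      (∃ f D g : ℝ → ℝ, SemiWave.IsData r f D g ∧ SemiWave.DHat r D ∧ SemiWave.GHat r g ∧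
        D 0 = 0 ∧ SemiWave.dot r D 0 = 0 ∧ c = SemiWave.dot r f 0 ∧
        ∃ (b : ℝ) (φ : ℝ → ℝ), SemiWave.IsSemiWavefrontFrom r f D g c 0 b φ ∧
          SemiWave.IsClassicalOn r f D g c (Set.Iio b) φ) ∧
      (∃ f D g : ℝ → ℝ, SemiWave.IsData r f D g ∧ SemiWave.DHat r D ∧ SemiWave.GHat r g ∧
        D 0 = 0 ∧ SemiWave.dot r D 0 = 0 ∧ c = SemiWave.dot r f 0 ∧
        ∃ (b : ℝ) (φ : ℝ → ℝ), SemiWave.IsSemiWavefrontFrom r f D g c 0 b φ ∧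
          SemiWave.IsSharpAt r f D g c (Set.Iio b) φ 0)) := by
  refine ⟨fun f D g hd hD hg c => ?_, (mainTheorem2_general r hr).2⟩
  obtain ⟨b, φ, hφ, htype, hstrict, hunique, hcases⟩ :=
    (mainTheorem2_general r hr).1 f D g hd hD hg c
  exact ⟨b, φ, hφ, htype, hstrict, fun b' φ' hφ' _ => hunique b' φ' hφ', hcases⟩
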